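/- Let $m,n\in\mathbb N$, let $X=\{x_1,\dots,x_m\}$ be a set of $m$ distinct points of $\mathbb R^3$, and put $r_j=r_j(x):=|x-x_j|$. Let $H$ be the operator in $L^2(\mathbb R^3,\mathbb C^n)$ given by $$H:=-\Delta\otimes I_n,\qquad \operatorname{dom}(H):=\{f\in W^2_2(\mathbb R^3,\mathbb C^n):\ f(x_j)=0,\ j=1,\dots,m\},$$ where $f(x_j)$ is the value of the continuous representative of $f$. Recall that, for a closed densely defined symmetric operator $A$ with equal deficiency indices in a Hilbert space $\mathfrak H$, a triplet $\{\mathcal H,\Gamma_0,\Gamma_1\}$ is a boundary triplet for $A^*$ if $\mathcal H$ is a Hilbert space and $\Gamma_0,\Gamma_1:\operatorname{dom}(A^*)\to\mathcal H$ are linear maps such that $(A^*f,g)_{\mathfrak H}-(f,A^*g)_{\mathfrak H}=(\Gamma_1f,\Gamma_0g)_{\mathcal H}-(\Gamma_0f,\Gamma_1g)_{\mathcal H}$ for all $f,g\in\operatorname{dom}(A^*)$ and $f\mapsto(\Gamma_0f,\Gamma_1f)$ maps $\operatorname{dom}(A^*)$ onto $\mathcal H\oplus\mathcal H$ (scalar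 products are linear in the first argument). Then the following assertions hold. (i) The domain of $H^*$ is $$\operatorname{dom}(H^*)=\Bigl\{f=\sum_{j=1}^m\Bigl(\xi_{0j}\frac{e^{-r_j}}{r_j}+\xi_{1j}e^{-r_j}\Bigr)+f_H:\ \xi_{0j},\xi_{1j}\in\mathbb C^n,\ f_H\in\operatorname{dom}(H)\Bigr\},$$ and the sum is direct: if $\sum_{j=1}^m\bigl(\xi_{0j}\frac{e^{-r_j}}{r_j}+\xi_{1j}e^{-r_j}\bigr)\in\operatorname{dom}(H)$, then all $\xi_{0j}$ and $\xi_{1j}$ are zero. (ii) $H$ is closed, densely defined and symmetric with equal deficiency indices. Every $f\in\operatorname{dom}(H^*)$ has a representative that is continuous on $\mathbb R^3\setminus X$, and with this representative the limits $$\Gamma_0f:=4\pi\Bigl\{\lim_{x\to x_j}f(x)|x-x_j|\Bigr\}_{j=1}^m=4\pi\{\xi_{0j}\}_{j=1}^m,\qquad \Gamma_1f:=\Bigl\{\lim_{x\to x_j}\Bigl(f(x)-\frac{\xi_{0j}}{|x-x_j|}\Bigr)\Bigr\}_{j=1}^m$$ exist, where $\xi_{0j}$ are the coefficients of $f$ in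 (i). With $\mathcal H=\bigoplus_{j=1}^m\mathbb C^n$, the triplet $\{\mathcal H,\Gamma_0,\Gamma_1\}$ is a boundary triplet for $H^*$. (iii) The operator $H_0:=H^*\upharpoonright\ker(\Gamma_0)$ is self-adjoint, and $\operatorname{dom}(H_0)=W^2_2(\mathbb R^3,\mathbb C^n)$. -/

import Mathlib

open MeasureTheory Filter Topology
open scoped LinearPMap SchwartzMap LineDeriv Laplacian

noncomputable section

namespace PointInteraction

/-! ### Boundary triplets in an abstract Hilbert space -/

section Abstract

variable {E : Type*} [NormedAddCommGroup E] [InnerProductSpace ℂ E] [CompleteSpace E]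
variable {K : Type*} [NormedAddCommGroup K] [InnerProductSpace ℂ K] [CompleteSpace K]

/-- The defect subspace `ker (A* - z)`. -/
def defectSubspace (A : E →ₗ.[ℂ] E) (z : ℂ) : Submodule ℂ E :=
  A†.graph.comap (LinearMap.prod LinearMap.id (z • LinearMap.id))

/-- `{K, Γ₀, Γ₁}` is a boundary triplet for `A*`, where `A` is a closed densely defined symmetric
operator with equal deficiency indices. A scalar product `(f, g)` that is linear in its first
argument is written `inner ℂ g f`. -/
structure IsBoundaryTriplet (A : E →ₗ.[ℂ] E) (Γ₀ Γ₁ : A†.domain →ₗ[ℂ] K) : Prop where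
  dense : Dense (A.domain : Set E)
  closed : A.IsClosed
  symmetric : A ≤ A†
  deficiency : Nonempty (defectSubspace A Complex.I ≃ₗᵢ[ℂ] defectSubspace A (-Complex.I))
  green : ∀ f g : A†.domain,
    inner ℂ (g : E) (A† f) - inner ℂ (A† g) (f : E)
      = inner ℂ (Γ₀ g) (Γ₁ f) - inner ℂ (Γ₁ g) (Γ₀ f)
  surjective : Function.Surjective fun f : A†.domain => (Γ₀ f, Γ₁ f)

/-- The restriction of `A*` to the kernel of a linear map `Γ` on `dom A*`. -/
def adjointRestrictKer (A : E →ₗ.[ℂ] E) (Γ : A†.domain →ₗ[ℂ] K) : E →ₗ.[ℂ] E :=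
  A†.domRestrict ((LinearMap.ker Γ).map A†.domain.subtype)

end Abstract

/-! ### The minimal operator -/

/-- `ℝ³`. -/
abbrev R3 : Type := EuclideanSpace ℝ (Fin 3)

/-- `ℂⁿ`. -/
abbrev Cn (n : ℕ) : Type := EuclideanSpace ℂ (Fin n)

/-- `L²(ℝ³, ℂⁿ)`. -/
abbrev L2 (n : ℕ) : Type := Lp (Cn n) 2 (volume : Measure R3)

/-- The boundary space `⊕_{j=1}^m ℂⁿ`. -/
abbrev BdSpace (m n : ℕ) : Type := PiLp 2 fun _ : Fin m => Cn n

/-- The embedding of `L²(ℝ³, ℂⁿ)` into the tempered distributions. -/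
abbrev toDist (n : ℕ) : L2 n →L[ℂ] 𝓢'(R3, Cn n) :=
  Lp.toTemperedDistributionCLM (Cn n) volume 2

theorem toDist_injective (n : ℕ) : Function.Injective (toDist n) :=
  LinearMap.ker_eq_bot.mp (Lp.ker_toTemperedDistributionCLM_eq_bot (μ := volume) (p := 2))

/-- A distribution that is given by an `L²` function. -/
def IsL2 {n : ℕ} (T : 𝓢'(R3, Cn n)) : Prop := T ∈ LinearMap.range (toDist n).toLinearMap

/-- The Sobolev space `W²₂(ℝ³, ℂⁿ)`: the `L²` functions all of whose weak derivatives of order one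
and two are in `L²`. -/
def W22 (n : ℕ) : Submodule ℂ (L2 n) where
  carrier := {f | (∀ v : R3, IsL2 (∂_{v} (toDist n f))) ∧
    ∀ v w : R3, IsL2 (∂_{v} (∂_{w} (toDist n f)))}
  zero_mem' := by
    refine ⟨fun v => ?_, fun v w => ?_⟩
    · rw [map_zero, LineDeriv.lineDerivOp_zero]
      exact Submodule.zero_mem _
    · rw [map_zero, LineDeriv.lineDerivOp_zero, LineDeriv.lineDerivOp_zero]
      exact Submodule.zero_mem _
  add_mem' := by
    intro f g hf hg
    refine ⟨fun v => ?_, fun v w => ?_⟩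
    · rw [map_add, LineDeriv.lineDerivOp_add]
      exact Submodule.add_mem _ (hf.1 v) (hg.1 v)
    · rw [map_add, LineDeriv.lineDerivOp_add, LineDeriv.lineDerivOp_add]
      exact Submodule.add_mem _ (hf.2 v w) (hg.2 v w)
  smul_mem' := by
    intro c f hf
    refine ⟨fun v => ?_, fun v w => ?_⟩
    · rw [map_smul, LineDeriv.lineDerivOp_smul]
      exact Submodule.smul_mem _ c (hf.1 v)
    · rw [map_smul, LineDeriv.lineDerivOp_smul, LineDeriv.lineDerivOp_smul]
      exact Submodule.smul_mem _ c (hf.2 v w)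

theorem exists_neg_laplacian {n : ℕ} (f : W22 n) :
    ∃ g : L2 n, toDist n g = -Δ (toDist n (f : L2 n)) := by
  have h : IsL2 (-Δ (toDist n (f : L2 n))) := by
    rw [TemperedDistribution.laplacian_eq_sum (stdOrthonormalBasis ℝ R3)]
    exact Submodule.neg_mem _ (Submodule.sum_mem _ fun i _ => f.2.2 _ _)
  exact h

/-- The operator `-Δ ⊗ Iₙ` in `L²(ℝ³, ℂⁿ)` with domain `W²₂(ℝ³, ℂⁿ)`; its value at `f` is the
`L²` function that represents the distribution `-Δ f`. -/
def negLaplacian (n : ℕ) : L2 n →ₗ.[ℂ] L2 n where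
  domain := W22 n
  toFun :=
    { toFun := fun f => (exists_neg_laplacian f).choose
      map_add' := by
        intro f g
        apply toDist_injective n
        rw [map_add, (exists_neg_laplacian f).choose_spec, (exists_neg_laplacian g).choose_spec,
          (exists_neg_laplacian (f + g)).choose_spec, Submodule.coe_add, map_add,
          ← TemperedDistribution.laplacianCLM_apply, ← TemperedDistribution.laplacianCLM_apply,
          ← TemperedDistribution.laplacianCLM_apply, map_add, neg_add]
      map_smul' := by
        intro c f
        apply toDist_injective n
        rw [RingHom.id_apply, map_smul, (exists_neg_laplacian f).choose_spec,
          (exists_neg_laplacian (c • f)).choose_spec, Submodule.coe_smul, map_smul,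
          ← TemperedDistribution.laplacianCLM_apply, ← TemperedDistribution.laplacianCLM_apply,
          map_smul, smul_neg] }

theorem toDist_negLaplacian {n : ℕ} (f : (negLaplacian n).domain) :
    toDist n (negLaplacian n f) = -Δ (toDist n (f : L2 n)) :=
  (exists_neg_laplacian f).choose_spec

/-- The `L²` functions whose continuous representative exists and vanishes at every `x j`. -/
def vanishingAt {m : ℕ} (n : ℕ) (x : Fin m → R3) : Submodule ℂ (L2 n) where
  carrier := {f | ∃ u : R3 → Cn n, Continuous u ∧ (f : R3 → Cn n) =ᵐ[volume] u ∧ ∀ j, u (x j) = 0}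
  zero_mem' := ⟨0, continuous_zero, Lp.coeFn_zero _ _ _, fun _ => rfl⟩
  add_mem' := by
    rintro f g ⟨u, hu, hfu, hu0⟩ ⟨v, hv, hgv, hv0⟩
    exact ⟨u + v, hu.add hv, (Lp.coeFn_add f g).trans (hfu.add hgv), fun j => by
      simp [hu0 j, hv0 j]⟩
  smul_mem' := by
    rintro c f ⟨u, hu, hfu, hu0⟩
    exact ⟨c • u, hu.const_smul c, (Lp.coeFn_smul c f).trans (hfu.const_smul c), fun j => by
      simp [hu0 j]⟩

/-- The minimal operator `H = -Δ ⊗ Iₙ` with domain `{f ∈ W²₂ : f(x_j) = 0 for all j}`. -/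
def minimalOp {m : ℕ} (n : ℕ) (x : Fin m → R3) : L2 n →ₗ.[ℂ] L2 n :=
  (negLaplacian n).domRestrict (vanishingAt n x)

/-! ### The functions `ξ e^{-|y-a|}/|y-a|` and `ξ e^{-|y-a|}` -/

theorem memLp_radial {n : ℕ} (φ : ℝ → ℝ) (hφ : Measurable φ)
    (hint : IntegrableOn (fun r : ℝ => r ^ 2 * φ r ^ 2) (Set.Ioi 0)) (a : R3) (ξ : Cn n) :
    MemLp (fun y : R3 => ((φ ‖y - a‖ : ℝ) : ℂ) • ξ) 2 volume := by
  have h1 : Integrable (fun y : R3 => φ ‖y‖ ^ 2) volume := by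
    rw [integrable_fun_norm_addHaar volume (f := fun r => φ r ^ 2)]
    simpa using hint
  have h2 : MemLp (fun y : R3 => φ ‖y - a‖) 2 volume := by
    have hm : AEStronglyMeasurable (fun y : R3 => φ ‖y - a‖) volume :=
      Measurable.aestronglyMeasurable (by fun_prop)
    exact (memLp_two_iff_integrable_sq hm).mpr (h1.comp_sub_right a)
  have h3 : MemLp (fun y : R3 => ((φ ‖y - a‖ : ℝ) : ℂ)) 2 volume := h2.ofReal
  refine MemLp.of_le_mul (c := ‖ξ‖) h3 (h3.1.smul_const ξ) (Eventually.of_forall fun y => ?_)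
  rw [norm_smul, mul_comm]

theorem memLp_exp_div {n : ℕ} (a : R3) (ξ : Cn n) :
    MemLp (fun y : R3 => ((Real.exp (-‖y - a‖) / ‖y - a‖ : ℝ) : ℂ) • ξ) 2 volume := by
  refine memLp_radial (fun r => Real.exp (-r) / r) (by fun_prop) ?_ a ξ
  refine (exp_neg_integrableOn_Ioi 0 (b := 2) two_pos).congr_fun (fun r hr => ?_) measurableSet_Ioi
  have hr' : r ≠ 0 := ne_of_gt hr
  have : Real.exp (-2 * r) = Real.exp (-r) ^ 2 := by
    rw [← Real.exp_nat_mul]; congr 1; push_cast; ring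
  simp only [this]
  field_simp

theorem memLp_exp {n : ℕ} (a : R3) (ξ : Cn n) :
    MemLp (fun y : R3 => ((Real.exp (-‖y - a‖) : ℝ) : ℂ) • ξ) 2 volume := by
  refine memLp_radial (fun r => Real.exp (-r)) (by fun_prop) ?_ a ξ
  have h := (Real.GammaIntegral_convergent (s := 3) (by norm_num))
  refine Integrable.mono' h (by fun_prop) ?_
  refine (ae_restrict_iff' measurableSet_Ioi).mpr (Eventually.of_forall fun r hr => ?_)
  have hr' : (0 : ℝ) < r := hr
  have h1 : Real.exp (-r) ≤ 1 := Real.exp_le_one_iff.mpr (by linarith)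
  have h2 : r ^ ((3 : ℝ) - 1) = r ^ 2 := by norm_num
  have h3 : 0 < Real.exp (-r) := Real.exp_pos _
  rw [Real.norm_of_nonneg (by positivity), h2]
  nlinarith [mul_le_mul_of_nonneg_left h1 (by positivity : 0 ≤ r ^ 2 * Real.exp (-r))]

/-- The element `ξ e^{-|y-a|}/|y-a|` of `L²(ℝ³, ℂⁿ)`. -/
def expDiv {n : ℕ} (a : R3) (ξ : Cn n) : L2 n := (memLp_exp_div a ξ).toLp _

/-- The element `ξ e^{-|y-a|}` of `L²(ℝ³, ℂⁿ)`. -/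
def expDecay {n : ℕ} (a : R3) (ξ : Cn n) : L2 n := (memLp_exp a ξ).toLp _

/-- The sum `∑_j (ξ₀ⱼ e^{-r_j}/r_j + ξ₁ⱼ e^{-r_j})`, `r_j = |y - x_j|`. -/
def singularSum {m n : ℕ} (x : Fin m → R3) (ξ₀ ξ₁ : Fin m → Cn n) : L2 n :=
  ∑ j, (expDiv (x j) (ξ₀ j) + expDecay (x j) (ξ₁ j))

/-! ### Boundary values -/

/-- `h₀ = 4π {lim_{y → x_j} f(y) |y - x_j|}_j` and
`h₁ = {lim_{y → x_j} (f(y) - ξ₀ⱼ / |y - x_j|)}_j` with `ξ₀ⱼ = lim_{y → x_j} f(y) |y - x_j|`. All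
limits are required to exist, and the values `f(y)` are those of the representative of `f` that is
continuous off the points `x_j` (there is at most one such, up to its values at the `x_j`). -/
def HasBoundaryValues {m n : ℕ} (x : Fin m → R3) (f : L2 n) (h₀ h₁ : BdSpace m n) : Prop :=
  ∃ u : R3 → Cn n, ContinuousOn u (Set.range x)ᶜ ∧ (f : R3 → Cn n) =ᵐ[volume] u ∧
    ∀ j, ∃ ξ : Cn n,
      Tendsto (fun y => ((‖y - x j‖ : ℝ) : ℂ) • u y) (𝓝[≠] x j) (𝓝 ξ) ∧
      h₀ j = ((4 * Real.pi : ℝ) : ℂ) • ξ ∧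
      Tendsto (fun y => u y - ((‖y - x j‖⁻¹ : ℝ) : ℂ) • ξ) (𝓝[≠] x j) (𝓝 (h₁ j))

end PointInteraction

end

/-!
Let `R = (1 - Δ)⁻¹`. Since `1 - Δ` maps `e^{-rⱼ}/(4π rⱼ)` to the point mass at `x j`, the inner
product of `(e^{-rⱼ}/rⱼ) ξ` with `g` is `4π` times that of `ξ` with `(R g)(x j)`. Hence `H` is the
restriction of `R⁻¹ - 1` to the functions `R g` with `g` orthogonal to the finite-dimensional space
`N` spanned by the `(e^{-rⱼ}/rⱼ) ξ`, and `dom H* = N + ran R`. As `e^{-rⱼ} = R (2 e^{-rⱼ}/rⱼ)`,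
splitting `g = k + g'` along `N ⊕ Nᗮ` in `R g` gives the decomposition of `dom H*`. In terms of
`f = G ξ + R g` with `G ξ = ∑ⱼ e^{-rⱼ}/(4π rⱼ) ξⱼ`, the boundary maps are `Γ₀ f = ξ` and
`Γ₁ f = G* g + M ξ`, where `M`, the finite part of `G` at the points, is symmetric; Green's identity
and surjectivity follow from this by linear algebra.
-/

namespace PointInteraction

open scoped RealInnerProductSpace FourierTransform

/-! ### Fourier transforms of radial functions in dimension three -/

section Radial

variable {F : Type*} [NormedAddCommGroup F] [NormedSpace ℂ F]

theorem fourier_radial_congr {V V' : Type*} [NormedAddCommGroup V] [InnerProductSpace ℝ V]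
    [FiniteDimensional ℝ V] [MeasurableSpace V] [BorelSpace V] [NormedAddCommGroup V']
    [InnerProductSpace ℝ V'] [FiniteDimensional ℝ V'] [MeasurableSpace V'] [BorelSpace V']
    (hdim : Module.finrank ℝ V = Module.finrank ℝ V') (φ : ℝ → F) {w : V} {w' : V'}
    (hw : ‖w‖ = ‖w'‖) : 𝓕 (fun v : V => φ ‖v‖) w = 𝓕 (fun v : V' => φ ‖v‖) w' := by
  let A : V ≃ₗᵢ[ℝ] V' := ((stdOrthonormalBasis ℝ V).reindex (finCongr hdim)).equiv
    (stdOrthonormalBasis ℝ V') (Equiv.refl _)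
  let B : V ≃ₗᵢ[ℝ] V' := A.trans (ℝ ∙ (A w - w'))ᗮ.reflection
  have hB : B w = w' := Submodule.reflection_sub (by rw [A.norm_map, hw])
  have hφ : (fun v : V' => φ ‖v‖) ∘ B = fun v : V => φ ‖v‖ := by
    ext v
    simp only [Function.comp_apply, B.norm_map]
  rw [← hφ, Real.fourier_comp_linearIsometry, hB]

theorem hasDerivAt_sqrt_sq_add_sq {s : ℝ} (hs : s ≠ 0) (ρ : ℝ) :
    HasDerivAt (fun ρ => √(s ^ 2 + ρ ^ 2)) (ρ / √(s ^ 2 + ρ ^ 2)) ρ := by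
  have hpos : s ^ 2 + ρ ^ 2 ≠ 0 := by positivity
  convert ((hasDerivAt_pow 2 ρ).const_add (s ^ 2)).sqrt hpos using 1
  field_simp
  ring

theorem tendsto_sqrt_sq_add_sq_atTop (s : ℝ) : Tendsto (fun ρ => √(s ^ 2 + ρ ^ 2)) atTop atTop :=
  Real.tendsto_sqrt_atTop.comp
    (tendsto_atTop_add_const_left _ _ (tendsto_pow_atTop two_ne_zero))

theorem integral_plane_radial [CompleteSpace F] {φ Φ : ℝ → F}
    (hΦ : ∀ r > 0, HasDerivAt Φ (-(r • φ r)) r) (hΦ₀ : Tendsto Φ atTop (𝓝 0)) {s : ℝ} (hs : s ≠ 0)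
    (hint : Integrable fun y : EuclideanSpace ℝ (Fin 2) => φ √(s ^ 2 + ‖y‖ ^ 2)) :
    ∫ y : EuclideanSpace ℝ (Fin 2), φ √(s ^ 2 + ‖y‖ ^ 2) = (2 * Real.pi) • Φ |s| := by
  have hderiv : ∀ ρ, HasDerivAt (fun ρ => Φ √(s ^ 2 + ρ ^ 2)) (-(ρ • φ √(s ^ 2 + ρ ^ 2))) ρ := by
    intro ρ
    have hr : 0 < √(s ^ 2 + ρ ^ 2) := by positivity
    convert! (hΦ _ hr).scomp ρ (hasDerivAt_sqrt_sq_add_sq hs ρ) using 1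
    rw [smul_neg, smul_smul, div_mul_cancel₀ _ hr.ne']
  rw [integrable_fun_norm_addHaar volume (f := fun ρ => φ √(s ^ 2 + ρ ^ 2))] at hint
  have hslice := integral_Ioi_of_hasDerivAt_of_tendsto' (fun ρ _ => hderiv ρ)
    (by simpa using hint.neg) (hΦ₀.comp (tendsto_sqrt_sq_add_sq_atTop s))
  rw [integral_neg] at hslice
  rw [integral_fun_norm_addHaar volume fun ρ => φ √(s ^ 2 + ρ ^ 2)]
  have hdisc : volume.real (Metric.ball (0 : EuclideanSpace ℝ (Fin 2)) 1) = Real.pi := by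
    simp [measureReal_def, Real.pi_nonneg]
  simp only [finrank_euclideanSpace_fin, Nat.add_one_sub_one, pow_one, hdisc]
  rw [neg_eq_iff_eq_neg.1 hslice]
  simp [Real.sqrt_sq_eq_abs, two_smul, ← add_smul, two_mul]

theorem fourier_radial_eq_fourier_slice [CompleteSpace F] {V : Type*} [NormedAddCommGroup V]
    [InnerProductSpace ℝ V] [FiniteDimensional ℝ V] [MeasurableSpace V] [BorelSpace V]
    (hV : Module.finrank ℝ V = 3)
    {φ Φ : ℝ → F} (hφ : IntegrableOn (fun r => r ^ 2 • φ r) (Set.Ioi 0))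
    (hΦ : ∀ r > 0, HasDerivAt Φ (-(r • φ r)) r) (hΦ₀ : Tendsto Φ atTop (𝓝 0)) (w : V) :
    𝓕 (fun v : V => φ ‖v‖) w = (2 * Real.pi) • 𝓕 (fun s : ℝ => Φ |s|) ‖w‖ := by
  let Plane := EuclideanSpace ℝ (Fin 2)
  have hdim : Module.finrank ℝ V = Module.finrank ℝ (WithLp 2 (ℝ × Plane)) := by
    rw [hV, LinearEquiv.finrank_eq (WithLp.linearEquiv 2 ℝ (ℝ × Plane))]
    simp [Plane]
  have hmp := WithLp.volume_preserving_toLp (U := ℝ) (V := Plane)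
  have hint : Integrable fun p : ℝ × Plane => φ √(p.1 ^ 2 + ‖p.2‖ ^ 2) := by
    have h : Integrable fun v : WithLp 2 (ℝ × Plane) => φ ‖v‖ := by
      rwa [integrable_fun_norm_addHaar, ← hdim, hV]
    simpa [Function.comp_def, WithLp.prod_norm_eq_of_L2] using
      (hmp.integrable_comp_emb (MeasurableEquiv.toLp 2 (ℝ × Plane)).measurableEmbedding).2 h
  have hw : ‖w‖ = ‖WithLp.toLp 2 (‖w‖, (0 : Plane))‖ := by
    simp
  have hint' : Integrable fun p : ℝ × Plane => 𝐞 (-⟪p.1, ‖w‖⟫) • φ √(p.1 ^ 2 + ‖p.2‖ ^ 2) := by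
    refine hint.norm.mono' (AEStronglyMeasurable.smul ?_ hint.1) (.of_forall fun p => ?_)
    · have h : Continuous fun p : ℝ × Plane => (𝐞 (-⟪p.1, ‖w‖⟫) : ℂ) := by fun_prop
      exact h.aestronglyMeasurable
    · rw [Circle.norm_smul]
  -- Rotate `w` onto the first axis of `ℝ × ℝ²` and integrate over the planes orthogonal to it.
  rw [fourier_radial_congr hdim φ hw, Real.fourier_eq, Real.fourier_eq,
    ← hmp.integral_comp (MeasurableEquiv.toLp 2 (ℝ × Plane)).measurableEmbedding]
  simp only [WithLp.prod_inner_apply, inner_zero_right, add_zero, WithLp.prod_norm_eq_of_L2,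
    WithLp.toLp_fst, WithLp.toLp_snd, Real.norm_eq_abs, sq_abs]
  rw [Measure.volume_eq_prod, integral_prod _ hint', ← integral_smul]
  refine integral_congr_ae ?_
  filter_upwards [hint.prod_right_ae, Measure.ae_ne volume 0] with s hs hs0
  simp only [Circle.smul_def]
  rw [integral_smul, integral_plane_radial hΦ hΦ₀ hs0 hs, smul_comm]

end Radial

theorem integrableOn_pow_mul_cexp_neg_mul (m : ℕ) {a : ℂ} (ha : 0 < a.re) :
    IntegrableOn (fun s : ℝ => (s : ℂ) ^ m * Complex.exp (-(a * s))) (Set.Ioi 0) := by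
  have hint : IntegrableOn (fun s : ℝ => s ^ m * Real.exp (-a.re * s)) (Set.Ioi 0) := by
    simpa using integrableOn_rpow_mul_exp_neg_mul_rpow (s := m) (p := 1)
      (neg_one_lt_zero.trans_le m.cast_nonneg) one_pos ha
  refine hint.mono' (by fun_prop) ((ae_restrict_mem measurableSet_Ioi).mono fun s hs => ?_)
  rw [norm_mul, norm_pow, Complex.norm_real, Real.norm_of_nonneg (le_of_lt hs), Complex.norm_exp]
  simp

theorem integral_pow_mul_cexp_neg_mul_Ioi (m : ℕ) {a : ℂ} (ha : 0 < a.re) :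
    ∫ s in Set.Ioi (0 : ℝ), (s : ℂ) ^ m * Complex.exp (-(a * s)) = m.factorial / a ^ (m + 1) := by
  have ha0 : a ≠ 0 := by
    rintro rfl
    exact ha.false
  induction m with
  | zero => simpa [neg_mul] using integral_exp_mul_complex_Ioi (a := -a) (by simpa using ha) 0
  | succ m ih =>
    have hm := integrableOn_pow_mul_cexp_neg_mul m ha
    have hm' := integrableOn_pow_mul_cexp_neg_mul (m + 1) ha
    have hderiv : ∀ s ∈ Set.Ici (0 : ℝ), HasDerivAt
        (fun s : ℝ => (s : ℂ) ^ (m + 1) * Complex.exp (-(a * s)))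
        ((m + 1) * ((s : ℂ) ^ m * Complex.exp (-(a * s)))
          - a * ((s : ℂ) ^ (m + 1) * Complex.exp (-(a * s)))) s := fun s _ => by
      convert! ((hasDerivAt_pow (m + 1) (s : ℂ)).mul
        ((hasDerivAt_id (s : ℂ)).const_mul a).neg.cexp).comp_ofReal using 1
      simp only [Nat.cast_add, Nat.cast_one, add_tsub_cancel_right, id_eq, Pi.neg_apply, mul_one,
        mul_neg]
      ring
    have hparts := integral_Ioi_of_hasDerivAt_of_tendsto' hderiv
      ((hm.const_mul _).sub (hm'.const_mul _))
      (tendsto_zero_of_hasDerivAt_of_integrableOn_Ioi (fun s hs => hderiv s (Set.mem_Ioi.1 hs).le)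
        ((hm.const_mul _).sub (hm'.const_mul _)) hm')
    rw [integral_sub (hm.const_mul _) (hm'.const_mul _), integral_const_mul, integral_const_mul,
      ih] at hparts
    have hI : a * ∫ s in Set.Ioi (0 : ℝ), (s : ℂ) ^ (m + 1) * Complex.exp (-(a * s))
        = (m + 1) * (m.factorial / a ^ (m + 1)) := by
      refine (sub_eq_zero.1 (hparts.trans ?_)).symm
      simp
    rw [eq_div_iff (pow_ne_zero _ ha0), pow_succ, ← mul_assoc, mul_right_comm, mul_comm _ a, hI,
      Nat.factorial_succ]
    push_cast
    field_simp

theorem integrable_comp_abs {F : Type*} [NormedAddCommGroup F] [NormedSpace ℝ F] {ψ : ℝ → F}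
    (hψ : IntegrableOn ψ (Set.Ioi 0)) : Integrable fun s : ℝ => ψ |s| := by
  simpa using (integrable_fun_norm_addHaar (volume : Measure ℝ) (f := ψ)).2 (by simpa using hψ)

theorem fourier_comp_abs {F : Type*} [NormedAddCommGroup F] [NormedSpace ℂ F] {ψ : ℝ → F}
    (hψ : IntegrableOn ψ (Set.Ioi 0)) (k : ℝ) :
    𝓕 (fun s => ψ |s|) k
      = (∫ s in Set.Ioi 0, 𝐞 (s * k) • ψ s) + ∫ s in Set.Ioi 0, 𝐞 (-(s * k)) • ψ s := by
  have hk : Integrable fun s : ℝ => 𝐞 (-(s * k)) • ψ |s| := by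
    simpa [mul_comm] using (Real.fourierIntegral_convergent_iff k).2 (integrable_comp_abs hψ)
  rw [Real.fourier_real_eq,
    ← intervalIntegral.integral_Iic_add_Ioi (b := 0) hk.integrableOn hk.integrableOn]
  congr 1
  · rw [← neg_zero, ← integral_comp_neg_Ioi (0 : ℝ) fun s => 𝐞 (-(s * k)) • ψ |s|, neg_zero]
    refine setIntegral_congr_fun measurableSet_Ioi fun s (hs : 0 < s) => ?_
    simp [abs_of_pos hs]
  · refine setIntegral_congr_fun measurableSet_Ioi fun s (hs : 0 < s) => ?_
    simp only [abs_of_pos hs]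

theorem integrableOn_pow_mul_exp_neg (m : ℕ) :
    IntegrableOn (fun s : ℝ => ((s ^ m * Real.exp (-s) : ℝ) : ℂ)) (Set.Ioi 0) := by
  simpa using integrableOn_pow_mul_cexp_neg_mul m (a := 1) (by simp)

/-- The symbol `(1 + |2πw|²)⁻¹` of `(1 - Δ)⁻¹`, for the Fourier transform with kernel
`e^{-2πi⟨v, w⟩}`. -/
noncomputable def resolventSymbol {V : Type*} [Norm V] (w : V) : ℝ :=
  (1 + 4 * Real.pi ^ 2 * ‖w‖ ^ 2)⁻¹

theorem one_add_mul_one_sub_mul_resolventSymbol (k : ℝ) :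
    (1 + 2 * Real.pi * k * Complex.I) * (1 - 2 * Real.pi * k * Complex.I) * resolventSymbol k
      = 1 := by
  have h : (1 + 2 * Real.pi * k * Complex.I) * (1 - 2 * Real.pi * k * Complex.I)
      = ((1 + 4 * Real.pi ^ 2 * ‖k‖ ^ 2 : ℝ) : ℂ) := by
    rw [Real.norm_eq_abs, sq_abs]
    push_cast
    linear_combination (-4 * Real.pi ^ 2 * k ^ 2 : ℂ) * Complex.I_sq
  rw [h, ← Complex.ofReal_mul, resolventSymbol, mul_inv_cancel₀ (by positivity),
    Complex.ofReal_one]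

theorem fourier_abs_pow_mul_exp_neg_abs (m : ℕ) (k : ℝ) :
    𝓕 (fun s : ℝ => ((|s| ^ m * Real.exp (-|s|) : ℝ) : ℂ)) k
      = m.factorial * resolventSymbol k ^ (m + 1) * ((1 + 2 * Real.pi * k * Complex.I) ^ (m + 1)
        + (1 - 2 * Real.pi * k * Complex.I) ^ (m + 1)) := by
  have hσ := one_add_mul_one_sub_mul_resolventSymbol k
  have hadd : (1 + 2 * Real.pi * k * Complex.I)⁻¹
      = (1 - 2 * Real.pi * k * Complex.I) * resolventSymbol k :=
    inv_eq_of_mul_eq_one_right (by rw [← mul_assoc, hσ])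
  have hsub : (1 - 2 * Real.pi * k * Complex.I)⁻¹
      = (1 + 2 * Real.pi * k * Complex.I) * resolventSymbol k :=
    inv_eq_of_mul_eq_one_right (by rw [← mul_assoc, mul_comm (1 - _), hσ])
  have hlaplace : 𝓕 (fun s : ℝ => ((|s| ^ m * Real.exp (-|s|) : ℝ) : ℂ)) k
      = m.factorial / (1 - 2 * Real.pi * k * Complex.I) ^ (m + 1)
        + m.factorial / (1 + 2 * Real.pi * k * Complex.I) ^ (m + 1) := by
    rw [fourier_comp_abs (integrableOn_pow_mul_exp_neg m),
      ← integral_pow_mul_cexp_neg_mul_Ioi m (by simp),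
      ← integral_pow_mul_cexp_neg_mul_Ioi m (by simp)]
    congr 1 <;>
    · refine integral_congr_ae (Eventually.of_forall fun s => ?_)
      simp only [Circle.smul_def, Real.fourierChar_apply, smul_eq_mul, Complex.ofReal_mul,
        Complex.ofReal_pow, Complex.ofReal_exp]
      rw [mul_left_comm, ← Complex.exp_add]
      congr 2
      push_cast
      ring
  rw [hlaplace, div_eq_mul_inv, div_eq_mul_inv, ← inv_pow, ← inv_pow, hadd, hsub,
    mul_pow, mul_pow]
  ring

theorem fourier_exp_neg_abs (k : ℝ) :
    𝓕 (fun s : ℝ => ((Real.exp (-|s|) : ℝ) : ℂ)) k = ((2 * resolventSymbol k : ℝ) : ℂ) := by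
  have h := fourier_abs_pow_mul_exp_neg_abs 0 k
  simp only [pow_zero, one_mul, zero_add, pow_one, Nat.factorial_zero, Nat.cast_one] at h
  rw [h]
  push_cast
  ring

theorem fourier_one_add_abs_mul_exp_neg_abs (k : ℝ) :
    𝓕 (fun s : ℝ => (((1 + |s|) * Real.exp (-|s|) : ℝ) : ℂ)) k
      = ((4 * resolventSymbol k ^ 2 : ℝ) : ℂ) := by
  have hint := fun m => integrable_comp_abs (integrableOn_pow_mul_exp_neg m)
  have hsum : (fun s : ℝ => (((1 + |s|) * Real.exp (-|s|) : ℝ) : ℂ))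
      = (fun s : ℝ => ((|s| ^ 0 * Real.exp (-|s|) : ℝ) : ℂ))
        + fun s : ℝ => ((|s| ^ 1 * Real.exp (-|s|) : ℝ) : ℂ) := by
    ext s
    simp [add_mul]
  have hadd := congrFun (VectorFourier.fourierIntegral_add Real.continuous_fourierChar
    (L := innerₗ ℝ) continuous_inner (hint 0) (hint 1)) k
  rw [hsum]
  refine (hadd.trans (congrArg₂ (· + ·) (fourier_abs_pow_mul_exp_neg_abs 0 k)
    (fourier_abs_pow_mul_exp_neg_abs 1 k))).trans ?_
  push_cast
  simp only [Nat.factorial_zero, Nat.factorial_one, Nat.cast_one]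
  linear_combination (-2 * resolventSymbol k : ℂ) * one_add_mul_one_sub_mul_resolventSymbol k

section FourierExp

variable {V : Type*} [NormedAddCommGroup V] [InnerProductSpace ℝ V] [FiniteDimensional ℝ V]
  [MeasurableSpace V] [BorelSpace V]

theorem integrableOn_sq_smul_exp_div :
    IntegrableOn (fun r : ℝ => r ^ 2 • ((Real.exp (-r) / r : ℝ) : ℂ)) (Set.Ioi 0) := by
  refine (integrableOn_pow_mul_cexp_neg_mul 1 (a := 1) (by simp)).congr_fun
    (fun r (hr : 0 < r) => ?_) measurableSet_Ioi
  have : (r : ℂ) ≠ 0 := mod_cast hr.ne'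
  simp only [pow_one, one_mul, Complex.ofReal_div, Complex.ofReal_exp, Complex.ofReal_neg,
    Complex.real_smul, Complex.ofReal_pow]
  field_simp

theorem integrableOn_sq_smul_exp :
    IntegrableOn (fun r : ℝ => r ^ 2 • ((Real.exp (-r) : ℝ) : ℂ)) (Set.Ioi 0) := by
  simpa using integrableOn_pow_mul_cexp_neg_mul 2 (a := 1) (by simp)

theorem integrable_exp_div (hV : Module.finrank ℝ V = 3) :
    Integrable fun v : V => ((Real.exp (-‖v‖) / ‖v‖ : ℝ) : ℂ) := by
  have : Nontrivial V := Module.nontrivial_of_finrank_pos (R := ℝ) (by omega)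
  rw [integrable_fun_norm_addHaar volume (f := fun r => ((Real.exp (-r) / r : ℝ) : ℂ)), hV]
  exact integrableOn_sq_smul_exp_div

theorem integrable_exp (hV : Module.finrank ℝ V = 3) :
    Integrable fun v : V => ((Real.exp (-‖v‖) : ℝ) : ℂ) := by
  have : Nontrivial V := Module.nontrivial_of_finrank_pos (R := ℝ) (by omega)
  rw [integrable_fun_norm_addHaar volume (f := fun r => ((Real.exp (-r) : ℝ) : ℂ)), hV]
  exact integrableOn_sq_smul_exp

theorem fourier_exp_div (hV : Module.finrank ℝ V = 3) (w : V) :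
    𝓕 (fun v : V => ((Real.exp (-‖v‖) / ‖v‖ : ℝ) : ℂ)) w
      = ((4 * Real.pi * resolventSymbol w : ℝ) : ℂ) := by
  have hΦ : ∀ r : ℝ, 0 < r → HasDerivAt (fun r : ℝ => ((Real.exp (-r) : ℝ) : ℂ))
      (-(r • ((Real.exp (-r) / r : ℝ) : ℂ))) r := fun r hr => by
    convert (hasDerivAt_neg r).exp.ofReal_comp using 1
    have : (r : ℂ) ≠ 0 := mod_cast hr.ne'
    simp only [Complex.ofReal_div, Complex.ofReal_exp, Complex.ofReal_neg, Complex.real_smul,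
      mul_neg, mul_one, neg_inj]
    field_simp
  have hΦ₀ : Tendsto (fun r : ℝ => ((Real.exp (-r) : ℝ) : ℂ)) atTop (𝓝 0) :=
    mod_cast (Complex.continuous_ofReal.tendsto 0).comp Real.tendsto_exp_neg_atTop_nhds_zero
  rw [fourier_radial_eq_fourier_slice hV integrableOn_sq_smul_exp_div hΦ hΦ₀,
    fourier_exp_neg_abs, ← Complex.coe_smul, smul_eq_mul, ← Complex.ofReal_mul]
  simp only [resolventSymbol, norm_norm]
  congr 1
  ring

theorem fourier_exp (hV : Module.finrank ℝ V = 3) (w : V) :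
    𝓕 (fun v : V => ((Real.exp (-‖v‖) : ℝ) : ℂ)) w
      = ((8 * Real.pi * resolventSymbol w ^ 2 : ℝ) : ℂ) := by
  have hΦ : ∀ r : ℝ, 0 < r → HasDerivAt (fun r : ℝ => (((1 + r) * Real.exp (-r) : ℝ) : ℂ))
      (-(r • ((Real.exp (-r) : ℝ) : ℂ))) r := fun r _ => by
    convert! (((hasDerivAt_id r).const_add 1).mul (hasDerivAt_neg r).exp).ofReal_comp using 1
    rw [Complex.real_smul, ← Complex.ofReal_mul, ← Complex.ofReal_neg, id]
    congr 1
    ring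
  have hΦ₀ : Tendsto (fun r : ℝ => (((1 + r) * Real.exp (-r) : ℝ) : ℂ)) atTop (𝓝 0) := by
    have h : Tendsto (fun r : ℝ => (1 + r) * Real.exp (-r)) atTop (𝓝 0) := by
      simpa [add_mul] using Real.tendsto_exp_neg_atTop_nhds_zero.add
        (Real.tendsto_pow_mul_exp_neg_atTop_nhds_zero 1)
    exact mod_cast (Complex.continuous_ofReal.tendsto 0).comp h
  rw [fourier_radial_eq_fourier_slice hV integrableOn_sq_smul_exp hΦ hΦ₀,
    fourier_one_add_abs_mul_exp_neg_abs, ← Complex.coe_smul, smul_eq_mul, ← Complex.ofReal_mul]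
  simp only [resolventSymbol, norm_norm]
  congr 1
  ring

end FourierExp

/-! ### The resolvent of the Laplacian -/

section FourierLp

variable {V F : Type*} [NormedAddCommGroup V] [InnerProductSpace ℝ V] [FiniteDimensional ℝ V]
  [MeasurableSpace V] [BorelSpace V] [NormedAddCommGroup F] [InnerProductSpace ℂ F]

theorem continuous_fourierInv {f : V → F} (hf : Integrable f) : Continuous (𝓕⁻ f) :=
  VectorFourier.fourierIntegral_continuous Real.continuous_fourierChar
    (continuous_inner (𝕜 := ℝ) (E := V)).neg hf

variable [CompleteSpace F]

theorem ae_eq_of_toTemperedDistribution_apply_eq {p : ENNReal} [Fact (1 ≤ p)]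
    {f : Lp F p (volume : Measure V)} {u : V → F} (hu : Continuous u)
    (h : ∀ g : 𝓢(V, ℂ), Lp.toTemperedDistribution f g = ∫ v, g v • u v) : f =ᵐ[volume] u := by
  refine ae_eq_of_integral_contDiff_smul_eq ((Lp.memLp f).locallyIntegrable Fact.out)
    hu.locallyIntegrable fun g hg hgc => ?_
  have hsupp : HasCompactSupport (Complex.ofRealCLM ∘ g) := hgc.comp_left rfl
  have := h (hsupp.toSchwartzMap (Complex.ofRealCLM.contDiff.comp hg))
  simpa using this

theorem fourier_toLp_ae_eq {f : V → F} (h₁ : Integrable f) (h₂ : MemLp f 2 volume) :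
    (𝓕 (h₂.toLp f) : Lp F 2 (volume : Measure V)) =ᵐ[volume] 𝓕 f := by
  have hcont : Continuous (𝓕 f) :=
    VectorFourier.fourierIntegral_continuous Real.continuous_fourierChar continuous_inner h₁
  refine ae_eq_of_toTemperedDistribution_apply_eq hcont fun g => ?_
  rw [← Lp.fourier_toTemperedDistribution_eq, TemperedDistribution.fourier_apply,
    Lp.toTemperedDistribution_apply]
  have hflip := VectorFourier.integral_fourierIntegral_smul_eq_flip (L := innerₗ V)
    Real.continuous_fourierChar continuous_inner (g.integrable (μ := volume)) h₁
  rw [flip_innerₗ] at hflip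
  refine Eq.trans (integral_congr_ae ?_) hflip
  filter_upwards [h₂.coeFn_toLp] with v hv
  rw [hv]
  rfl

theorem fourierInv_toLp_ae_eq {f : V → F} (h₁ : Integrable f) (h₂ : MemLp f 2 volume) :
    (𝓕⁻ (h₂.toLp f) : Lp F 2 (volume : Measure V)) =ᵐ[volume] 𝓕⁻ f := by
  have hinner : Continuous fun p : V × V => (-innerₗ V) p.1 p.2 :=
    (continuous_inner (𝕜 := ℝ) (E := V)).neg
  refine ae_eq_of_toTemperedDistribution_apply_eq (continuous_fourierInv h₁) fun g => ?_
  rw [← Lp.fourierInv_toTemperedDistribution_eq, TemperedDistribution.fourierInv_apply,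
    Lp.toTemperedDistribution_apply]
  have hflip := VectorFourier.integral_fourierIntegral_smul_eq_flip (L := -innerₗ V)
    Real.continuous_fourierChar hinner (g.integrable (μ := volume)) h₁
  rw [show (-innerₗ V).flip = -innerₗ V by ext v w; simp [real_inner_comm]] at hflip
  refine Eq.trans (integral_congr_ae ?_) hflip
  filter_upwards [h₂.coeFn_toLp] with v hv
  rw [hv, SchwartzMap.fourierInv_coe]
  rfl

end FourierLp

section ResolventSymbol

variable {V : Type*} [NormedAddCommGroup V]

theorem resolventSymbol_pos (w : V) : 0 < resolventSymbol w := by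
  unfold resolventSymbol
  positivity

theorem resolventSymbol_mul_one_add :
    ((fun w => (resolventSymbol w : ℂ)) * fun w => ((1 + 4 * Real.pi ^ 2 * ‖w‖ ^ 2 : ℝ) : ℂ))
      = fun _ : V => 1 := by
  ext w
  rw [Pi.mul_apply, ← Complex.ofReal_mul, resolventSymbol, inv_mul_cancel₀ (by positivity),
    Complex.ofReal_one]

theorem one_add_norm_sq_mul_resolventSymbol_le (w : V) :
    (1 + ‖w‖ ^ 2) * resolventSymbol w ≤ 1 := by
  rw [resolventSymbol, mul_inv_le_iff₀ (by positivity), one_mul]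
  gcongr
  exact le_mul_of_one_le_left (by positivity) (by nlinarith [Real.pi_gt_three])

theorem resolventSymbol_le_one (w : V) : resolventSymbol w ≤ 1 :=
  (le_mul_of_one_le_left (resolventSymbol_pos w).le (by simp)).trans
    (one_add_norm_sq_mul_resolventSymbol_le w)

variable [InnerProductSpace ℝ V]

theorem hasTemperateGrowth_resolventSymbol :
    (fun w : V => (resolventSymbol w : ℂ)).HasTemperateGrowth := by
  have hscale : (fun w : V => (2 * Real.pi) • w).HasTemperateGrowth :=
    ((2 * Real.pi) • ContinuousLinearMap.id ℝ V).hasTemperateGrowth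
  convert! Complex.ofRealCLM.hasTemperateGrowth.comp
    ((Function.hasTemperateGrowth_one_add_norm_sq_rpow V (-1)).comp hscale) using 1
  ext w
  simp only [Function.comp, resolventSymbol, norm_smul, Real.rpow_neg_one, mul_pow, norm_mul,
    Real.norm_eq_abs, sq_abs, abs_two, Complex.ofRealCLM_apply]
  norm_num

theorem continuous_resolventSymbol : Continuous fun w : V => (resolventSymbol w : ℂ) :=
  hasTemperateGrowth_resolventSymbol.1.continuous

variable [FiniteDimensional ℝ V] [MeasurableSpace V] [BorelSpace V]

theorem memLp_two_resolventSymbol (hV : Module.finrank ℝ V < 4) :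
    MemLp (fun w : V => (resolventSymbol w : ℂ)) 2 volume := by
  have hm := (continuous_resolventSymbol (V := V)).aestronglyMeasurable (μ := volume)
  rw [memLp_two_iff_integrable_sq_norm hm]
  have hint : Integrable (fun w : V => (1 + ‖w‖ ^ 2) ^ (-(4 : ℝ) / 2)) volume :=
    integrable_rpow_neg_one_add_norm_sq (mod_cast hV)
  refine hint.mono' (hm.norm.pow 2) (Eventually.of_forall fun w => ?_)
  rw [norm_pow, norm_norm, Complex.norm_real, Real.norm_of_nonneg (resolventSymbol_pos w).le,
    show -(4 : ℝ) / 2 = -(2 : ℕ) by norm_num, Real.rpow_neg (by positivity), Real.rpow_natCast,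
    ← inv_pow]
  refine pow_le_pow_left₀ (resolventSymbol_pos w).le ?_ 2
  rw [← one_div, le_div_iff₀' (by positivity)]
  exact one_add_norm_sq_mul_resolventSymbol_le w

theorem memLp_top_resolventSymbol : MemLp (fun w : V => (resolventSymbol w : ℂ)) ⊤ volume := by
  refine memLp_top_of_bound continuous_resolventSymbol.aestronglyMeasurable 1
    (Eventually.of_forall fun w => ?_)
  rw [Complex.norm_real, Real.norm_of_nonneg (resolventSymbol_pos w).le]
  exact resolventSymbol_le_one w

end ResolventSymbol

section FreeResolvent

variable {V F : Type*} [NormedAddCommGroup V] [InnerProductSpace ℝ V] [FiniteDimensional ℝ V]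
  [MeasurableSpace V] [BorelSpace V] [NormedAddCommGroup F] [InnerProductSpace ℂ F]

/-- Multiplication by the symbol of `(1 - Δ)⁻¹`. -/
noncomputable def mulResolventSymbol :
    Lp F 2 (volume : Measure V) →L[ℂ] Lp F 2 (volume : Measure V) :=
  (ContinuousLinearMap.lsmul ℂ ℂ).holderL volume ⊤ 2 2 (memLp_top_resolventSymbol.toLp _)

theorem mulResolventSymbol_apply (f : Lp F 2 (volume : Measure V)) :
    mulResolventSymbol f = (memLp_top_resolventSymbol (V := V)).toLp _ • f := rfl

theorem coeFn_mulResolventSymbol (f : Lp F 2 (volume : Measure V)) :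
    mulResolventSymbol f =ᵐ[volume] fun w => (resolventSymbol w : ℂ) • f w := by
  filter_upwards [Lp.coeFn_lpSMul (r := 2) (memLp_top_resolventSymbol.toLp _) f,
    memLp_top_resolventSymbol.coeFn_toLp] with w h₁ h₂
  rw [mulResolventSymbol_apply, h₁, Pi.smul_apply', h₂]

theorem sub_laplacian_eq_fourierMultiplierCLM (T : 𝓢'(V, F)) :
    T - Δ T = TemperedDistribution.fourierMultiplierCLM F
      (fun w => ((1 + 4 * Real.pi ^ 2 * ‖w‖ ^ 2 : ℝ) : ℂ)) T := by
  have hsymbol : (fun w : V => ((1 + 4 * Real.pi ^ 2 * ‖w‖ ^ 2 : ℝ) : ℂ))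
      = (fun _ => 1) + (((2 * Real.pi) ^ 2 : ℝ) : ℂ) • fun w : V => ((‖w‖ ^ 2 : ℝ) : ℂ) := by
    ext w
    simp only [Pi.add_apply, Pi.smul_apply, smul_eq_mul]
    push_cast
    ring
  have hsq : (fun w : V => ((‖w‖ ^ 2 : ℝ) : ℂ)).HasTemperateGrowth := by fun_prop
  rw [TemperedDistribution.laplacian_eq_fourierMultiplierCLM,
    TemperedDistribution.fourierMultiplierCLM_apply,
    TemperedDistribution.fourierMultiplierCLM_apply, hsymbol,
    TemperedDistribution.smulLeftCLM_add (by fun_prop) (by fun_prop),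
    TemperedDistribution.smulLeftCLM_smul hsq, add_apply,
    TemperedDistribution.smulLeftCLM_const, one_smul, FourierTransform.fourierInv_add,
    FourierTransform.fourierInv_fourier_eq, smul_apply,
    FourierTransform.fourierInv_smul, neg_smul, sub_neg_eq_add]
  rfl

variable [CompleteSpace F]

/-- The resolvent `(1 - Δ)⁻¹` of the free Laplacian on `L²`, as a Fourier multiplier. -/
noncomputable def freeResolvent :
    Lp F 2 (volume : Measure V) →L[ℂ] Lp F 2 (volume : Measure V) :=
  (Lp.fourierTransformₗᵢ V F).symm.toContinuousLinearEquiv.toContinuousLinearMap ∘L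
    mulResolventSymbol ∘L
      (Lp.fourierTransformₗᵢ V F).toContinuousLinearEquiv.toContinuousLinearMap

theorem freeResolvent_apply (g : Lp F 2 (volume : Measure V)) :
    freeResolvent g = 𝓕⁻ (mulResolventSymbol (𝓕 g)) := rfl

theorem fourier_freeResolvent (g : Lp F 2 (volume : Measure V)) :
    𝓕 (freeResolvent g) = mulResolventSymbol (𝓕 g) := by
  rw [freeResolvent_apply, FourierTransform.fourier_fourierInv_eq]

theorem isSymmetric_freeResolvent :
    (freeResolvent : Lp F 2 (volume : Measure V) →L[ℂ] _).IsSymmetric := by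
  intro f g
  change inner ℂ (freeResolvent f) g = inner ℂ f (freeResolvent g)
  rw [← Lp.inner_fourier_eq, ← Lp.inner_fourier_eq f, fourier_freeResolvent,
    fourier_freeResolvent, L2.inner_def, L2.inner_def]
  refine integral_congr_ae ?_
  filter_upwards [coeFn_mulResolventSymbol (𝓕 f), coeFn_mulResolventSymbol (𝓕 g)] with w h₁ h₂
  rw [h₁, h₂, inner_smul_left, inner_smul_right, Complex.conj_ofReal]

theorem toTemperedDistribution_freeResolvent (g : Lp F 2 (volume : Measure V)) :
    Lp.toTemperedDistribution (freeResolvent g) = TemperedDistribution.fourierMultiplierCLM F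
      (fun w => (resolventSymbol w : ℂ)) (Lp.toTemperedDistribution g) := by
  rw [freeResolvent_apply, ← Lp.fourierInv_toTemperedDistribution_eq, mulResolventSymbol_apply,
    Lp.toTemperedDistribution_smul_eq hasTemperateGrowth_resolventSymbol,
    ← Lp.fourier_toTemperedDistribution_eq, TemperedDistribution.fourierMultiplierCLM_apply]

theorem freeResolvent_sub_laplacian (g : Lp F 2 (volume : Measure V)) :
    (freeResolvent g : 𝓢'(V, F)) - Δ (freeResolvent g : 𝓢'(V, F)) = g := by
  rw [sub_laplacian_eq_fourierMultiplierCLM, toTemperedDistribution_freeResolvent,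
    TemperedDistribution.fourierMultiplierCLM_fourierMultiplierCLM_apply
      hasTemperateGrowth_resolventSymbol (by fun_prop), resolventSymbol_mul_one_add,
    TemperedDistribution.fourierMultiplierCLM_const, one_smul, ContinuousLinearMap.id_apply]

theorem toTemperedDistribution_injective : Function.Injective
    (Lp.toTemperedDistribution : Lp F 2 (volume : Measure V) → 𝓢'(V, F)) :=
  LinearMap.ker_eq_bot.mp (Lp.ker_toTemperedDistributionCLM_eq_bot (μ := volume) (p := 2))

theorem freeResolvent_injective :
    Function.Injective (freeResolvent : Lp F 2 (volume : Measure V) →L[ℂ] _) := fun f g h =>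
  toTemperedDistribution_injective <| by
    rw [← freeResolvent_sub_laplacian f, h, freeResolvent_sub_laplacian]

theorem freeResolvent_eq_of_sub_laplacian_eq {f g : Lp F 2 (volume : Measure V)}
    (h : (f : 𝓢'(V, F)) - Δ (f : 𝓢'(V, F)) = g) : freeResolvent g = f := by
  apply toTemperedDistribution_injective
  rw [toTemperedDistribution_freeResolvent, ← h, sub_laplacian_eq_fourierMultiplierCLM,
    TemperedDistribution.fourierMultiplierCLM_fourierMultiplierCLM_apply (by fun_prop)
      hasTemperateGrowth_resolventSymbol, mul_comm, resolventSymbol_mul_one_add,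
    TemperedDistribution.fourierMultiplierCLM_const, one_smul, ContinuousLinearMap.id_apply]

theorem memSobolev_freeResolvent (g : Lp F 2 (volume : Measure V)) :
    TemperedDistribution.MemSobolev 2 2 (freeResolvent g : 𝓢'(V, F)) := by
  rw [show (2 : ℝ) = 2 + 0 by norm_num, ← TemperedDistribution.memSobolev_besselPotential_iff,
    TemperedDistribution.besselPotential, toTemperedDistribution_freeResolvent,
    TemperedDistribution.fourierMultiplierCLM_fourierMultiplierCLM_apply
      hasTemperateGrowth_resolventSymbol (by fun_prop)]
  refine TemperedDistribution.MemSobolev.fourierMultiplierCLM_of_bounded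
    (TemperedDistribution.memSobolev_zero_iff.2 ⟨g, rfl⟩)
    (hasTemperateGrowth_resolventSymbol.mul (by fun_prop)) ⟨1, fun w => ?_⟩
  have hpos := resolventSymbol_pos w
  rw [Pi.mul_apply, ← Complex.ofReal_mul, Complex.norm_real, div_self (two_ne_zero' ℝ),
    Real.rpow_one, Real.norm_of_nonneg (by positivity), mul_comm]
  exact one_add_norm_sq_mul_resolventSymbol_le w

end FreeResolvent

section NegLaplacian

variable {n : ℕ}

theorem isL2_of_memSobolev {s : ℝ} (hs : 0 ≤ s) {T : 𝓢'(R3, Cn n)}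
    (h : TemperedDistribution.MemSobolev s 2 T) : IsL2 T := by
  obtain ⟨f, hf⟩ := TemperedDistribution.memSobolev_zero_iff.1 (h.mono hs)
  exact ⟨f, hf.symm⟩

theorem freeResolvent_mem_W22 (g : L2 n) : freeResolvent g ∈ W22 n := by
  have h := memSobolev_freeResolvent g
  exact ⟨fun v => isL2_of_memSobolev (by norm_num) (h.lineDerivOp (m := v)),
    fun v w => isL2_of_memSobolev (by norm_num) ((h.lineDerivOp (m := w)).lineDerivOp (m := v))⟩

theorem freeResolvent_add_negLaplacian (f : (negLaplacian n).domain) :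
    freeResolvent ((f : L2 n) + negLaplacian n f) = f := by
  refine freeResolvent_eq_of_sub_laplacian_eq (Eq.symm ?_)
  change toDist n ((f : L2 n) + negLaplacian n f) = _
  rw [map_add, toDist_negLaplacian, sub_eq_add_neg]
  rfl

theorem negLaplacian_freeResolvent (g : L2 n) :
    negLaplacian n ⟨freeResolvent g, freeResolvent_mem_W22 g⟩ = g - freeResolvent g := by
  apply toDist_injective n
  have h : toDist n (freeResolvent g) - Δ (toDist n (freeResolvent g)) = toDist n g :=
    freeResolvent_sub_laplacian g
  rw [toDist_negLaplacian, map_sub, ← h]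
  abel

theorem mem_W22_iff {f : L2 n} : f ∈ W22 n ↔ ∃ g, freeResolvent g = f :=
  ⟨fun hf => ⟨_, freeResolvent_add_negLaplacian ⟨f, hf⟩⟩,
    fun ⟨g, hg⟩ => hg ▸ freeResolvent_mem_W22 g⟩

end NegLaplacian

/-! ### Symmetric restrictions of the inverse of a self-adjoint operator -/

section Krein

variable {E : Type*} [NormedAddCommGroup E] [InnerProductSpace ℂ E]

/-- `H` is the restriction of the self-adjoint operator `R⁻¹ - 1` to the vectors `f` for which
`R⁻¹ f` is orthogonal to `N`. The subspace `N`, which meets the range of `R` trivially, is then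
the defect subspace of `H` at `-1`. -/
structure IsResolventRestriction (R : E →L[ℂ] E) (N : Submodule ℂ E) (H : E →ₗ.[ℂ] E) :
    Prop where
  isSymmetric : R.IsSymmetric
  eq_zero_of_apply_mem : ∀ ⦃f⦄, R f ∈ N → f = 0
  mem_graph_iff : ∀ p : E × E, p ∈ H.graph ↔ R (p.1 + p.2) = p.1 ∧ p.1 + p.2 ∈ Nᗮ

theorem isUnit_one_sub_smul [CompleteSpace E] {R : E →L[ℂ] E} (hR : R.IsSymmetric) {z : ℂ}
    (hz : z.im ≠ 0) : IsUnit (1 - z • R) := by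
  have hsa : IsSelfAdjoint R := ContinuousLinearMap.isSelfAdjoint_iff_isSymmetric.2 hR
  have hz₀ : z ≠ 0 := by
    rintro rfl
    exact hz rfl
  have hspec : z⁻¹ ∉ spectrum ℂ R := fun hmem => by
    have := hsa.im_eq_zero_of_mem_spectrum hmem
    rw [Complex.inv_im, div_eq_zero_iff, neg_eq_zero, Complex.normSq_eq_zero] at this
    exact this.elim hz hz₀
  have hfactor : 1 - z • R = z • (algebraMap ℂ (E →L[ℂ] E) z⁻¹ - R) := by
    rw [smul_sub, Algebra.algebraMap_eq_smul_one, smul_smul, mul_inv_cancel₀ hz₀, one_smul]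
  rw [hfactor]
  exact (spectrum.notMem_iff.1 hspec).smul (Units.mk0 z hz₀)

variable {K : Type*} [NormedAddCommGroup K] [InnerProductSpace ℂ K]

theorem surjective_adjoint_of_injective [CompleteSpace E] [FiniteDimensional ℂ K]
    {G : K →L[ℂ] E} (hG : Function.Injective G) :
    Function.Surjective (ContinuousLinearMap.adjoint G) := by
  refine LinearMap.range_eq_top.1 ?_
  rw [← Submodule.orthogonal_orthogonal (LinearMap.range _),
    ContinuousLinearMap.orthogonal_range, ContinuousLinearMap.adjoint_adjoint,
    LinearMap.ker_eq_bot.2 hG, Submodule.bot_orthogonal_eq_top]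

variable {R : E →L[ℂ] E} {N : Submodule ℂ E} {H : E →ₗ.[ℂ] E} {G : K →L[ℂ] E}

namespace IsResolventRestriction

theorem mem_domain_iff (hH : IsResolventRestriction R N H) {f : E} :
    f ∈ H.domain ↔ ∃ g ∈ Nᗮ, R g = f := by
  rw [LinearPMap.mem_domain_iff]
  constructor
  · rintro ⟨h, hh⟩
    obtain ⟨hR, hN⟩ := (hH.mem_graph_iff _).1 hh
    exact ⟨_, hN, hR⟩
  · rintro ⟨g, hg, rfl⟩
    exact ⟨g - R g, (hH.mem_graph_iff _).2 (by simpa using hg)⟩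

theorem isClosed (hH : IsResolventRestriction R N H) : H.IsClosed := by
  have hgraph : (H.graph : Set (E × E)) =
      {p | R (p.1 + p.2) = p.1} ∩ (fun p : E × E => p.1 + p.2) ⁻¹' (Nᗮ : Set E) :=
    Set.ext hH.mem_graph_iff
  rw [LinearPMap.IsClosed, hgraph]
  exact (isClosed_eq (by fun_prop) (by fun_prop)).inter
    ((Submodule.isClosed_orthogonal N).preimage (by fun_prop))

theorem eq_and_eq_of_add_apply_eq (hH : IsResolventRestriction R G.range H)
    (hG : Function.Injective G) {ξ η : K} {g h : E} (heq : G ξ + R g = G η + R h) :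
    ξ = η ∧ g = h := by
  have hsub : R (g - h) = G (η - ξ) := by
    rw [map_sub, map_sub, sub_eq_sub_iff_add_eq_add, add_comm, heq]
  have hgh : g - h = 0 := hH.eq_zero_of_apply_mem (hsub ▸ ⟨_, rfl⟩)
  rw [hgh, map_zero] at hsub
  have hξη : η - ξ = 0 := hG (by rw [← hsub, map_zero])
  exact ⟨(sub_eq_zero.1 hξη).symm, sub_eq_zero.1 hgh⟩

variable [CompleteSpace E]

section Projection

variable [N.HasOrthogonalProjection]

theorem dense_domain (hH : IsResolventRestriction R N H) : Dense (H.domain : Set E) := by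
  rw [Submodule.dense_iff_topologicalClosure_eq_top, Submodule.topologicalClosure_eq_top_iff,
    Submodule.eq_bot_iff]
  intro f hf
  apply hH.eq_zero_of_apply_mem
  rw [← Submodule.orthogonal_orthogonal N, Submodule.mem_orthogonal]
  intro g hg
  rw [← (Submodule.mem_orthogonal _ _).1 hf (R g) (hH.mem_domain_iff.2 ⟨g, hg, rfl⟩)]
  exact (hH.isSymmetric g f).symm

theorem mem_graph_adjoint_iff (hH : IsResolventRestriction R N H) (p : E × E) :
    p ∈ H†.graph ↔ p.1 - R (p.1 + p.2) ∈ N := by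
  rw [LinearPMap.adjoint_graph_eq_graph_adjoint hH.dense_domain, Submodule.mem_adjoint_iff]
  have hpair : ∀ g : E, inner ℂ (g - R g) p.1 - inner ℂ (R g) p.2
      = inner ℂ g (p.1 - R (p.1 + p.2)) := by
    intro g
    have h₁ : inner ℂ (R g) p.1 = inner ℂ g (R p.1) := hH.isSymmetric g p.1
    have h₂ : inner ℂ (R g) p.2 = inner ℂ g (R p.2) := hH.isSymmetric g p.2
    rw [map_add, inner_sub_left, inner_sub_right, inner_add_right, h₁, h₂]
    ring
  constructor
  · intro h
    rw [← Submodule.orthogonal_orthogonal N, Submodule.mem_orthogonal]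
    intro g hg
    rw [← hpair]
    exact h _ _ ((hH.mem_graph_iff _).2 (by simpa using hg))
  · intro h a b hab
    obtain ⟨hR, hN⟩ := (hH.mem_graph_iff _).1 hab
    have hab' := hpair (a + b)
    rw [show R (a + b) = a from hR, add_sub_cancel_left] at hab'
    exact hab'.trans ((Submodule.mem_orthogonal' _ _).1 hN _ h)

theorem mem_domain_adjoint_iff (hH : IsResolventRestriction R N H) {f : E} :
    f ∈ H†.domain ↔ ∃ k ∈ N, ∃ g, f = k + R g := by
  rw [LinearPMap.mem_domain_iff]
  constructor
  · rintro ⟨h, hh⟩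
    exact ⟨_, (hH.mem_graph_adjoint_iff _).1 hh, f + h, by simp⟩
  · rintro ⟨k, hk, g, rfl⟩
    exact ⟨g - (k + R g), (hH.mem_graph_adjoint_iff _).2 (by simpa using hk)⟩

theorem le_adjoint (hH : IsResolventRestriction R N H) : H ≤ H† := by
  rw [← LinearPMap.le_graph_iff]
  intro p hp
  rw [hH.mem_graph_adjoint_iff, ((hH.mem_graph_iff p).1 hp).1, sub_self]
  exact zero_mem _

theorem defectSubspace_eq_comap (hH : IsResolventRestriction R N H) (z : ℂ) :
    defectSubspace H z = N.comap (1 - (1 + z) • R : E →L[ℂ] E).toLinearMap := by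
  ext f
  rw [defectSubspace, Submodule.mem_comap, hH.mem_graph_adjoint_iff, Submodule.mem_comap]
  simp [add_smul]

theorem nonempty_equiv_defectSubspace (hH : IsResolventRestriction R N H) {z : ℂ}
    (hz : z.im ≠ 0) : Nonempty (N ≃ₗ[ℂ] defectSubspace H z) := by
  obtain ⟨u, hu⟩ : IsUnit (1 - (1 + z) • R) :=
    isUnit_one_sub_smul hH.isSymmetric (by simpa using hz)
  rw [hH.defectSubspace_eq_comap, ← hu]
  exact ⟨((ContinuousLinearEquiv.unitsEquiv ℂ E u).toLinearEquiv.ofSubmodule' N).symm⟩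

end Projection

theorem nonempty_defectSubspace_equiv [FiniteDimensional ℂ N]
    (hH : IsResolventRestriction R N H) :
    Nonempty (defectSubspace H Complex.I ≃ₗᵢ[ℂ] defectSubspace H (-Complex.I)) := by
  obtain ⟨e₁⟩ := hH.nonempty_equiv_defectSubspace (z := Complex.I) (by simp)
  obtain ⟨e₂⟩ := hH.nonempty_equiv_defectSubspace (z := -Complex.I) (by simp)
  have := Module.Finite.equiv e₁
  have := Module.Finite.equiv e₂
  exact ⟨((stdOrthonormalBasis ℂ _).reindex (finCongr
    (e₁.finrank_eq.symm.trans e₂.finrank_eq))).equiv (stdOrthonormalBasis ℂ _) (Equiv.refl _)⟩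

theorem isSelfAdjoint (hH : IsResolventRestriction R ⊥ H) : IsSelfAdjoint H := by
  rw [LinearPMap.isSelfAdjoint_def]
  apply LinearPMap.eq_of_eq_graph
  ext p
  rw [hH.mem_graph_adjoint_iff, hH.mem_graph_iff]
  simp [sub_eq_zero, eq_comm (a := p.1)]

variable [FiniteDimensional ℂ K]

/-- The first boundary map: the coefficient `ξ` in the decomposition `f = G ξ + R g` of
`f ∈ dom H†`, where `g = f + H† f`. -/
noncomputable def singularCoeff (hH : IsResolventRestriction R G.range H)
    (hG : Function.Injective G) : H†.domain →ₗ[ℂ] K :=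
  (LinearEquiv.ofInjective G.toLinearMap hG).symm.toLinearMap ∘ₗ
    (H†.domain.subtype - R.toLinearMap ∘ₗ (H†.domain.subtype + H†.toFun)).codRestrict G.range
      fun f => (hH.mem_graph_adjoint_iff (f, H† f)).1 (H†.mem_graph f)

theorem singularCoeff_add (hH : IsResolventRestriction R G.range H)
    (hG : Function.Injective G) (f : H†.domain) :
    G (hH.singularCoeff hG f) + R (f + H† f) = f := by
  have h : G (hH.singularCoeff hG f) = f - R (f + H† f) :=
    congrArg Subtype.val ((LinearEquiv.ofInjective G.toLinearMap hG).apply_symm_apply _)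
  rw [h, sub_add_cancel]

theorem singularCoeff_eq_and_eq (hH : IsResolventRestriction R G.range H)
    (hG : Function.Injective G) {f : H†.domain} {ξ : K} {g : E} (hf : (f : E) = G ξ + R g) :
    hH.singularCoeff hG f = ξ ∧ f + H† f = g :=
  hH.eq_and_eq_of_add_apply_eq hG ((hH.singularCoeff_add hG f).trans hf)

/-- The second boundary map `G* g + M ξ` on `f = G ξ + R g`. For point interactions `G* g`
evaluates `R g` at the interaction points and `M ξ` is the finite part of `G ξ` there. -/
noncomputable def regularValue (hH : IsResolventRestriction R G.range H)
    (hG : Function.Injective G) (M : K →ₗ[ℂ] K) : H†.domain →ₗ[ℂ] K :=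
  (ContinuousLinearMap.adjoint G).toLinearMap ∘ₗ (H†.domain.subtype + H†.toFun)
    + M ∘ₗ hH.singularCoeff hG

theorem regularValue_apply (hH : IsResolventRestriction R G.range H)
    (hG : Function.Injective G) (M : K →ₗ[ℂ] K) (f : H†.domain) :
    hH.regularValue hG M f
      = ContinuousLinearMap.adjoint G (f + H† f) + M (hH.singularCoeff hG f) :=
  rfl

theorem inner_adjoint_sub_inner_adjoint (hH : IsResolventRestriction R G.range H)
    (hG : Function.Injective G) {M : K →ₗ[ℂ] K} (hM : M.IsSymmetric) (f g : H†.domain) :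
    inner ℂ (g : E) (H† f) - inner ℂ (H† g) (f : E)
      = inner ℂ (hH.singularCoeff hG g) (hH.regularValue hG M f)
        - inner ℂ (hH.regularValue hG M g) (hH.singularCoeff hG f) := by
  have hleft : inner ℂ (g : E) (f + H† f)
      = inner ℂ (hH.singularCoeff hG g) (ContinuousLinearMap.adjoint G (f + H† f))
        + inner ℂ (R (g + H† g)) (f + H† f) := by
    rw [ContinuousLinearMap.adjoint_inner_right, ← inner_add_left, hH.singularCoeff_add]
  have hright : inner ℂ (g + H† g) (f : E)
      = inner ℂ (ContinuousLinearMap.adjoint G (g + H† g)) (hH.singularCoeff hG f)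
        + inner ℂ (g + H† g) (R (f + H† f)) := by
    rw [ContinuousLinearMap.adjoint_inner_left, ← inner_add_right, hH.singularCoeff_add]
  have hR : inner ℂ (R (g + H† g)) (f + H† f) = inner ℂ (g + H† g) (R (f + H† f)) :=
    hH.isSymmetric _ _
  rw [hH.regularValue_apply, hH.regularValue_apply, inner_add_left, inner_add_right, hM _ _]
  rw [inner_add_right] at hleft
  rw [inner_add_left] at hright
  linear_combination hleft - hright + hR

theorem surjective_singularCoeff_regularValue (hH : IsResolventRestriction R G.range H)
    (hG : Function.Injective G) (M : K →ₗ[ℂ] K) :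
    Function.Surjective fun f => (hH.singularCoeff hG f, hH.regularValue hG M f) := by
  rintro ⟨ξ, η⟩
  obtain ⟨g, hg⟩ := surjective_adjoint_of_injective hG (η - M ξ)
  let f : H†.domain := ⟨G ξ + R g, hH.mem_domain_adjoint_iff.2 ⟨_, ⟨ξ, rfl⟩, g, rfl⟩⟩
  obtain ⟨hξ, hfg⟩ := hH.singularCoeff_eq_and_eq hG (f := f) rfl
  have hη : hH.regularValue hG M f = η := by
    rw [hH.regularValue_apply, hξ, hfg, hg, sub_add_cancel]
  exact ⟨f, Prod.ext hξ hη⟩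

theorem isBoundaryTriplet (hH : IsResolventRestriction R G.range H)
    (hG : Function.Injective G) {M : K →ₗ[ℂ] K} (hM : M.IsSymmetric) :
    IsBoundaryTriplet H (hH.singularCoeff hG) (hH.regularValue hG M) where
  dense := hH.dense_domain
  closed := hH.isClosed
  symmetric := hH.le_adjoint
  deficiency := hH.nonempty_defectSubspace_equiv
  green := hH.inner_adjoint_sub_inner_adjoint hG hM
  surjective := hH.surjective_singularCoeff_regularValue hG M

theorem adjointRestrictKer (hH : IsResolventRestriction R G.range H)
    (hG : Function.Injective G) :
    IsResolventRestriction R ⊥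
      (PointInteraction.adjointRestrictKer H (hH.singularCoeff hG)) where
  isSymmetric := hH.isSymmetric
  eq_zero_of_apply_mem f hf :=
    hH.eq_zero_of_apply_mem ((Submodule.mem_bot ℂ).1 hf ▸ zero_mem _)
  mem_graph_iff p := by
    rw [Submodule.bot_orthogonal_eq_top, and_iff_left Submodule.mem_top, LinearPMap.mem_graph_iff]
    constructor
    · rintro ⟨y, hy, hy'⟩
      obtain ⟨f, hf, hfy⟩ := y.2.1
      have hval : PointInteraction.adjointRestrictKer H (hH.singularCoeff hG) y = H† f :=
        LinearPMap.domRestrict_apply hfy.symm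
      have hsum := hH.singularCoeff_add hG f
      rw [LinearMap.mem_ker.1 hf, map_zero, zero_add] at hsum
      rw [← hy', ← hy, hval, ← hfy]
      exact hsum
    · intro hp
      have hgraph : p ∈ H†.graph := by
        rw [hH.mem_graph_adjoint_iff, hp, sub_self]
        exact zero_mem _
      obtain ⟨f, hf, hf'⟩ := (LinearPMap.mem_graph_iff _).1 hgraph
      have hker : hH.singularCoeff hG f = 0 :=
        (hH.singularCoeff_eq_and_eq hG (g := p.1 + p.2) (by rw [map_zero, zero_add, hf, hp])).1
      exact ⟨⟨f, ⟨⟨f, hker, rfl⟩, f.2⟩⟩, hf, (LinearPMap.domRestrict_apply rfl).trans hf'⟩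

end IsResolventRestriction

end Krein

/-! ### The Green functions of `1 - Δ` at the interaction points -/

section ContinuousRepresentative

variable {V F : Type*} [NormedAddCommGroup V] [InnerProductSpace ℝ V] [FiniteDimensional ℝ V]
  [MeasurableSpace V] [BorelSpace V] [NormedAddCommGroup F] [InnerProductSpace ℂ F]

theorem integrable_mulResolventSymbol (hV : Module.finrank ℝ V < 4)
    (f : Lp F 2 (volume : Measure V)) : Integrable (mulResolventSymbol f : V → F) := by
  have h : MemLp (fun w : V => (resolventSymbol w : ℂ) • f w) 1 volume :=
    (Lp.memLp f).smul (memLp_two_resolventSymbol hV)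
  exact (memLp_one_iff_integrable.1 h).congr (coeFn_mulResolventSymbol f).symm

variable [CompleteSpace F]

/-- The continuous representative of `(1 - Δ)⁻¹ g`, which exists in dimension at most three. -/
noncomputable def freeResolventFun (g : Lp F 2 (volume : Measure V)) : V → F :=
  𝓕⁻ (mulResolventSymbol (𝓕 g) : V → F)

theorem continuous_freeResolventFun (hV : Module.finrank ℝ V < 4)
    (g : Lp F 2 (volume : Measure V)) : Continuous (freeResolventFun g) :=
  continuous_fourierInv (integrable_mulResolventSymbol hV (𝓕 g))

theorem freeResolvent_ae_eq (hV : Module.finrank ℝ V < 4) (g : Lp F 2 (volume : Measure V)) :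
    freeResolvent g =ᵐ[volume] freeResolventFun g := by
  have h := fourierInv_toLp_ae_eq (integrable_mulResolventSymbol hV (𝓕 g)) (Lp.memLp _)
  rwa [Lp.toLp_coeFn, ← freeResolvent_apply] at h

theorem fourier_comp_sub_smul (φ : V → ℂ) (a : V) (ξ : F) (w : V) :
    𝓕 (fun v => φ (v - a) • ξ) w = ((Real.fourierChar (-⟪a, w⟫) : ℂ) * 𝓕 φ w) • ξ := by
  rw [Real.fourier_eq, Real.fourier_eq, ← integral_add_right_eq_self _ a, ← smul_eq_mul,
    ← integral_smul, ← integral_smul_const]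
  congr 1
  ext1 v
  rw [add_sub_cancel_right, inner_add_left, neg_add, AddChar.map_add_eq_mul, Circle.smul_def,
    Circle.smul_def, Circle.coe_mul, smul_smul, smul_eq_mul, smul_eq_mul]
  congr 1
  ring

end ContinuousRepresentative

section ExpDiv

variable {n : ℕ}

theorem fourier_expDiv (a : R3) (ξ : Cn n) :
    (𝓕 (expDiv a ξ) : L2 n) =ᵐ[volume] fun w =>
      ((Real.fourierChar (-⟪a, w⟫) : ℂ) * ((4 * Real.pi * resolventSymbol w : ℝ) : ℂ)) • ξ := by
  have hint := ((integrable_exp_div finrank_euclideanSpace_fin).comp_sub_right a).smul_const ξ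
  filter_upwards [fourier_toLp_ae_eq hint (memLp_exp_div a ξ)] with w hw
  rw [expDiv, hw, fourier_comp_sub_smul (fun v : R3 => ((Real.exp (-‖v‖) / ‖v‖ : ℝ) : ℂ)),
    fourier_exp_div finrank_euclideanSpace_fin]

theorem fourier_expDecay (a : R3) (ξ : Cn n) :
    (𝓕 (expDecay a ξ) : L2 n) =ᵐ[volume] fun w =>
      ((Real.fourierChar (-⟪a, w⟫) : ℂ) * ((8 * Real.pi * resolventSymbol w ^ 2 : ℝ) : ℂ)) • ξ := by
  have hint := ((integrable_exp finrank_euclideanSpace_fin).comp_sub_right a).smul_const ξ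
  filter_upwards [fourier_toLp_ae_eq hint (memLp_exp a ξ)] with w hw
  rw [expDecay, hw, fourier_comp_sub_smul (fun v : R3 => ((Real.exp (-‖v‖) : ℝ) : ℂ)),
    fourier_exp finrank_euclideanSpace_fin]

theorem expDecay_eq_freeResolvent (a : R3) (ξ : Cn n) :
    expDecay a ξ = freeResolvent ((2 : ℂ) • expDiv a ξ) := by
  have hfourier : 𝓕 (expDecay a ξ) = 𝓕 (freeResolvent ((2 : ℂ) • expDiv a ξ)) := by
    rw [fourier_freeResolvent, FourierTransform.fourier_smul, map_smul]
    apply Lp.ext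
    filter_upwards [fourier_expDecay a ξ, fourier_expDiv a ξ,
      coeFn_mulResolventSymbol (𝓕 (expDiv a ξ)),
      Lp.coeFn_smul (2 : ℂ) (mulResolventSymbol (𝓕 (expDiv a ξ)))] with w h₁ h₂ h₃ h₄
    rw [h₁, h₄, Pi.smul_apply, h₃, h₂, smul_smul, smul_smul]
    congr 1
    push_cast
    ring
  exact (Lp.fourierTransformₗᵢ R3 (Cn n)).injective hfourier

theorem inner_expDiv (a : R3) (ξ : Cn n) (g : L2 n) :
    inner ℂ (expDiv a ξ) g = ((4 * Real.pi : ℝ) : ℂ) * inner ℂ ξ (freeResolventFun g a) := by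
  have hint : Integrable fun w : R3 =>
      Real.fourierChar ⟪w, a⟫ • (mulResolventSymbol (𝓕 g) : R3 → Cn n) w := by
    simpa using (Real.fourierIntegral_convergent_iff (-a)).2
      (integrable_mulResolventSymbol (by simp) (𝓕 g))
  rw [← Lp.inner_fourier_eq, L2.inner_def, freeResolventFun, Real.fourierInv_eq,
    ← integral_inner hint, ← integral_const_mul]
  refine integral_congr_ae ?_
  filter_upwards [fourier_expDiv a ξ, coeFn_mulResolventSymbol (𝓕 g)] with w h₁ h₂
  rw [h₁, h₂, Circle.smul_def, inner_smul_left, inner_smul_right, inner_smul_right, map_mul,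
    Complex.conj_ofReal, ← Circle.coe_inv_eq_conj, AddChar.map_neg_eq_inv, inv_inv,
    real_inner_comm]
  push_cast
  ring

theorem expDiv_add (a : R3) (ξ η : Cn n) : expDiv a (ξ + η) = expDiv a ξ + expDiv a η := by
  rw [expDiv, expDiv, expDiv, ← MemLp.toLp_add]
  congr 1
  ext1 y
  exact smul_add _ _ _

theorem expDiv_smul (a : R3) (c : ℂ) (ξ : Cn n) : expDiv a (c • ξ) = c • expDiv a ξ := by
  rw [expDiv, expDiv, ← MemLp.toLp_const_smul]
  congr 1
  ext1 y
  exact smul_comm _ _ _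

/-- `expDiv a` as a linear map. -/
noncomputable def expDivₗ (n : ℕ) (a : R3) : Cn n →ₗ[ℂ] L2 n where
  toFun := expDiv a
  map_add' := expDiv_add a
  map_smul' := expDiv_smul a

end ExpDiv

section GreenFun

/-- The Green function of `1 - Δ` on `ℝ³`, as a function of the distance to its pole. -/
noncomputable def greenKernel (r : ℝ) : ℝ := (4 * Real.pi)⁻¹ * (Real.exp (-r) / r)

theorem tendsto_greenKernel_sub :
    Tendsto (fun r => greenKernel r - r⁻¹ * (4 * Real.pi)⁻¹) (𝓝[>] 0)
      (𝓝 (-(4 * Real.pi)⁻¹)) := by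
  have hderiv : HasDerivAt (fun r : ℝ => Real.exp (-r)) (-1) 0 := by
    simpa using (hasDerivAt_neg (0 : ℝ)).exp
  have hslope := ((hasDerivAt_iff_tendsto_slope.1 hderiv).mono_left
    (nhdsWithin_mono 0 fun r (hr : 0 < r) => hr.ne')).const_mul (4 * Real.pi)⁻¹
  rw [mul_neg_one] at hslope
  refine hslope.congr fun r => ?_
  simp only [slope_def_field, greenKernel, sub_zero, neg_zero, Real.exp_zero]
  ring

variable {ι V F : Type*} [NormedAddCommGroup V]

theorem continuousAt_greenKernel_norm_sub {a y : V} (h : y ≠ a) :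
    ContinuousAt (fun y => greenKernel ‖y - a‖) y :=
  continuousAt_const.mul
    (ContinuousAt.div (by fun_prop) (by fun_prop) (norm_ne_zero_iff.2 (sub_ne_zero.2 h)))

section NormedSpace

variable [NormedAddCommGroup F] [NormedSpace ℂ F]

theorem tendsto_norm_smul_of_tendsto_sub {u : V → F} {a : V} {ξ l : F}
    (h : Tendsto (fun y => u y - ((‖y - a‖⁻¹ : ℝ) : ℂ) • ξ) (𝓝[≠] a) (𝓝 l)) :
    Tendsto (fun y => ((‖y - a‖ : ℝ) : ℂ) • u y) (𝓝[≠] a) (𝓝 ξ) := by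
  have hnorm : Tendsto (fun y => ((‖y - a‖ : ℝ) : ℂ)) (𝓝[≠] a) (𝓝 ((0 : ℝ) : ℂ)) :=
    (Complex.continuous_ofReal.tendsto _).comp
      (tendsto_nhds_of_tendsto_nhdsWithin (tendsto_norm_sub_self_nhdsNE a))
  have hprod := (hnorm.smul h).add_const ξ
  rw [Complex.ofReal_zero, zero_smul, zero_add] at hprod
  refine hprod.congr' ?_
  filter_upwards [self_mem_nhdsWithin] with y hy
  have hy₀ : ‖y - a‖ ≠ 0 := norm_ne_zero_iff.2 (sub_ne_zero.2 hy)
  rw [smul_sub, smul_smul, ← Complex.ofReal_mul, mul_inv_cancel₀ hy₀, Complex.ofReal_one,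
    one_smul, sub_add_cancel]

theorem tendsto_greenKernel_smul_sub (a : V) (ξ : F) :
    Tendsto (fun y => (greenKernel ‖y - a‖ : ℂ) • ξ
        - ((‖y - a‖⁻¹ : ℝ) : ℂ) • ((4 * Real.pi : ℝ) : ℂ)⁻¹ • ξ)
      (𝓝[≠] a) (𝓝 (-(((4 * Real.pi : ℝ) : ℂ)⁻¹ • ξ))) := by
  have h := ((Complex.continuous_ofReal.tendsto _).comp
    (tendsto_greenKernel_sub.comp (tendsto_norm_sub_self_nhdsNE a))).smul_const ξ
  simpa only [Function.comp_def, Complex.ofReal_sub, Complex.ofReal_mul, Complex.ofReal_inv,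
    Complex.ofReal_neg, sub_smul, neg_smul, mul_smul] using h

variable [Fintype ι]

/-- The superposition of the Green functions of `1 - Δ` with poles `x j` and weights `ξ j`. -/
noncomputable def greenFun (x : ι → V) (ξ : PiLp 2 fun _ : ι => F) (y : V) : F :=
  ∑ j, (greenKernel ‖y - x j‖ : ℂ) • ξ j

theorem continuousOn_greenFun (x : ι → V) (ξ : PiLp 2 fun _ : ι => F) :
    ContinuousOn (greenFun x ξ) (Set.range x)ᶜ := fun _ hy =>
  (tendsto_finsetSum _ fun j _ => ((Complex.continuous_ofReal.continuousAt.comp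
    (continuousAt_greenKernel_norm_sub fun h => hy ⟨j, h.symm⟩)).smul
      continuousAt_const).tendsto).mono_left nhdsWithin_le_nhds

/-- The finite parts of `greenFun x ξ` at the poles. The `j`-th summand of `greenFun x ξ (x j)`
vanishes because of the convention `1 / 0 = 0`. -/
noncomputable def greenFinitePart (x : ι → V) :
    (PiLp 2 fun _ : ι => F) →ₗ[ℂ] PiLp 2 fun _ : ι => F where
  toFun ξ := WithLp.toLp 2 fun j => greenFun x ξ (x j) - ((4 * Real.pi : ℝ) : ℂ)⁻¹ • ξ j
  map_add' ξ η := by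
    ext1 j
    simp only [greenFun, PiLp.add_apply, smul_add, Finset.sum_add_distrib]
    abel
  map_smul' c ξ := by
    ext1 j
    simp only [greenFun, PiLp.smul_apply, Finset.smul_sum, smul_sub, smul_comm c, RingHom.id_apply]

theorem tendsto_greenFun_sub {x : ι → V} (hx : Function.Injective x)
    (ξ : PiLp 2 fun _ : ι => F) (j : ι) :
    Tendsto (fun y => greenFun x ξ y
        - ((‖y - x j‖⁻¹ : ℝ) : ℂ) • ((4 * Real.pi : ℝ) : ℂ)⁻¹ • ξ j)
      (𝓝[≠] x j) (𝓝 (greenFinitePart x ξ j)) := by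
  classical
  let rest : V → F := fun y => ∑ k ∈ Finset.univ.erase j, (greenKernel ‖y - x k‖ : ℂ) • ξ k
  have hsplit : ∀ y, greenFun x ξ y = (greenKernel ‖y - x j‖ : ℂ) • ξ j + rest y := fun y =>
    (Finset.add_sum_erase _ _ (Finset.mem_univ j)).symm
  have hrest : ContinuousAt rest (x j) := tendsto_finsetSum _ fun k hk =>
    ((Complex.continuous_ofReal.continuousAt.comp (continuousAt_greenKernel_norm_sub
      (hx.ne (Finset.ne_of_mem_erase hk).symm))).smul continuousAt_const).tendsto
  have hvalue : greenFinitePart x ξ j = -(((4 * Real.pi : ℝ) : ℂ)⁻¹ • ξ j) + rest (x j) := by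
    change greenFun x ξ (x j) - _ = _
    rw [hsplit, sub_self, norm_zero, greenKernel, div_zero, mul_zero, Complex.ofReal_zero,
      zero_smul]
    abel
  rw [hvalue]
  refine ((tendsto_greenKernel_smul_sub (x j) (ξ j)).add
    (hrest.tendsto.mono_left nhdsWithin_le_nhds)).congr fun y => ?_
  rw [hsplit]
  abel

end NormedSpace

theorem isSymmetric_greenFinitePart [Fintype ι] [NormedAddCommGroup F] [InnerProductSpace ℂ F]
    (x : ι → V) : (greenFinitePart (F := F) x).IsSymmetric := by
  intro ξ η
  simp only [greenFinitePart, LinearMap.coe_mk, AddHom.coe_mk, PiLp.inner_apply, inner_sub_left,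
    inner_sub_right, greenFun, sum_inner, inner_sum, inner_smul_left, inner_smul_right,
    map_inv₀, Complex.conj_ofReal, Finset.sum_sub_distrib]
  congr 1
  rw [Finset.sum_comm]
  simp_rw [norm_sub_rev]

end GreenFun

/-! ### The minimal operator -/

section MinimalOp

variable {m n : ℕ} {x : Fin m → R3}

/-- The map `ξ ↦ ∑ⱼ e^{-rⱼ}/(4π rⱼ) ξⱼ` onto the defect subspace of the minimal operator at `-1`.
The factor `1/(4π)` makes its adjoint evaluate `(1 - Δ)⁻¹ g` at the points `x j`. -/
noncomputable def greenMap (n : ℕ) (x : Fin m → R3) : BdSpace m n →L[ℂ] L2 n :=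
  ((4 * Real.pi : ℝ) : ℂ)⁻¹ •
    ∑ j, (expDivₗ n (x j)).toContinuousLinearMap ∘L PiLp.proj 2 (fun _ : Fin m => Cn n) j

theorem greenMap_apply (x : Fin m → R3) (ξ : BdSpace m n) :
    greenMap n x ξ = ((4 * Real.pi : ℝ) : ℂ)⁻¹ • ∑ j, expDiv (x j) (ξ j) := by
  rw [greenMap, smul_apply, sum_apply]
  rfl

theorem four_pi_ne_zero : ((4 * Real.pi : ℝ) : ℂ) ≠ 0 :=
  Complex.ofReal_ne_zero.2 (mul_ne_zero four_ne_zero Real.pi_ne_zero)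

theorem singularSum_eq (x : Fin m → R3) (ξ₀ ξ₁ : Fin m → Cn n) :
    singularSum x ξ₀ ξ₁ = greenMap n x (((4 * Real.pi : ℝ) : ℂ) • WithLp.toLp 2 ξ₀)
      + freeResolvent (greenMap n x ((2 * ((4 * Real.pi : ℝ) : ℂ)) • WithLp.toLp 2 ξ₁)) := by
  have hgreen : ∀ ξ : Fin m → Cn n, greenMap n x (((4 * Real.pi : ℝ) : ℂ) • WithLp.toLp 2 ξ)
      = ∑ j, expDiv (x j) (ξ j) := fun ξ => by
    rw [map_smul, greenMap_apply, smul_inv_smul₀ four_pi_ne_zero]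
  rw [mul_smul, (greenMap n x).map_smul 2, hgreen, hgreen]
  simp only [singularSum, Finset.sum_add_distrib, expDecay_eq_freeResolvent, Finset.smul_sum,
    map_sum]

theorem greenMap_ae_eq (x : Fin m → R3) (ξ : BdSpace m n) :
    greenMap n x ξ =ᵐ[volume] greenFun x ξ := by
  have hexpDiv : ∀ᵐ y, ∀ j, (expDiv (x j) (ξ j) : R3 → Cn n) y
      = ((Real.exp (-‖y - x j‖) / ‖y - x j‖ : ℝ) : ℂ) • ξ j :=
    ae_all_iff.2 fun j => (memLp_exp_div (x j) (ξ j)).coeFn_toLp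
  rw [greenMap_apply]
  filter_upwards [hexpDiv, Lp.coeFn_finsetSum Finset.univ fun j => expDiv (x j) (ξ j),
    Lp.coeFn_smul ((4 * Real.pi : ℝ) : ℂ)⁻¹ (∑ j, expDiv (x j) (ξ j))] with y hy hsum hsmul
  rw [hsmul, Pi.smul_apply, hsum, Finset.sum_apply, Finset.smul_sum, greenFun]
  refine Finset.sum_congr rfl fun j _ => ?_
  rw [hy j, smul_smul, greenKernel, Complex.ofReal_mul (4 * Real.pi)⁻¹, Complex.ofReal_inv]

theorem adjoint_greenMap_apply (x : Fin m → R3) (g : L2 n) :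
    ContinuousLinearMap.adjoint (greenMap n x) g
      = WithLp.toLp 2 fun j => freeResolventFun g (x j) := by
  refine ext_inner_left ℂ fun ξ => ?_
  rw [ContinuousLinearMap.adjoint_inner_right, greenMap_apply, inner_smul_left, sum_inner,
    map_inv₀, Complex.conj_ofReal, PiLp.inner_apply, Finset.mul_sum]
  refine Finset.sum_congr rfl fun j _ => ?_
  rw [inner_expDiv, inv_mul_cancel_left₀ four_pi_ne_zero]

theorem freeResolvent_mem_vanishingAt_iff {g : L2 n} :
    freeResolvent g ∈ vanishingAt n x ↔ g ∈ (greenMap n x).rangeᗮ := by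
  have hV : Module.finrank ℝ R3 < 4 := by simp
  have horth : g ∈ (greenMap n x).rangeᗮ ↔ ∀ j, freeResolventFun g (x j) = 0 := by
    rw [ContinuousLinearMap.orthogonal_range, LinearMap.mem_ker, ContinuousLinearMap.coe_coe,
      adjoint_greenMap_apply, PiLp.ext_iff]
    rfl
  rw [horth]
  constructor
  · rintro ⟨v, hv, hgv, hv₀⟩ j
    rw [← hv₀ j]
    exact congrFun (Measure.eq_of_ae_eq ((freeResolvent_ae_eq hV g).symm.trans hgv)
      (continuous_freeResolventFun hV g) hv) (x j)
  · exact fun h => ⟨_, continuous_freeResolventFun hV g, freeResolvent_ae_eq hV g, h⟩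

theorem hasBoundaryValues (hx : Function.Injective x) (ξ : BdSpace m n) (g : L2 n) :
    HasBoundaryValues x (greenMap n x ξ + freeResolvent g) ξ
      (ContinuousLinearMap.adjoint (greenMap n x) g + greenFinitePart x ξ) := by
  have hV : Module.finrank ℝ R3 < 4 := by simp
  have hcont := continuous_freeResolventFun hV g
  refine ⟨fun y => greenFun x ξ y + freeResolventFun g y,
    (continuousOn_greenFun x ξ).add hcont.continuousOn,
    (Lp.coeFn_add _ _).trans ((greenMap_ae_eq x ξ).add (freeResolvent_ae_eq hV g)), fun j => ?_⟩
  have hlim : Tendsto (fun y => greenFun x ξ y + freeResolventFun g y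
        - ((‖y - x j‖⁻¹ : ℝ) : ℂ) • ((4 * Real.pi : ℝ) : ℂ)⁻¹ • ξ j) (𝓝[≠] x j)
      (𝓝 ((ContinuousLinearMap.adjoint (greenMap n x) g + greenFinitePart x ξ) j)) := by
    rw [adjoint_greenMap_apply]
    refine (((hcont.tendsto (x j)).mono_left nhdsWithin_le_nhds).add
      (tendsto_greenFun_sub hx ξ j)).congr fun y => ?_
    abel
  exact ⟨((4 * Real.pi : ℝ) : ℂ)⁻¹ • ξ j, tendsto_norm_smul_of_tendsto_sub hlim,
    (smul_inv_smul₀ four_pi_ne_zero _).symm, hlim⟩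

theorem compl_range_mem_nhdsNE (hx : Function.Injective x) (j : Fin m) :
    (Set.range x)ᶜ ∈ 𝓝[≠] x j := by
  have hother : (x '' {j}ᶜ)ᶜ ∈ 𝓝 (x j) :=
    ((Set.toFinite _).image x).isClosed.isOpen_compl.mem_nhds fun ⟨_, hk, hkj⟩ => hk (hx hkj)
  filter_upwards [mem_nhdsWithin_of_mem_nhds hother, self_mem_nhdsWithin] with y hy hyj
  rintro ⟨k, rfl⟩
  exact hy ⟨k, fun hk => hyj (congrArg x hk), rfl⟩

theorem eq_zero_of_greenMap_ae_eq (hx : Function.Injective x) {ξ : BdSpace m n} {u : R3 → Cn n}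
    (hu : Continuous u) (h : greenMap n x ξ =ᵐ[volume] u) : ξ = 0 := by
  have heq : Set.EqOn (greenFun x ξ) u (Set.range x)ᶜ :=
    Measure.eqOn_open_of_ae_eq (ae_restrict_of_ae ((greenMap_ae_eq x ξ).symm.trans h))
      (Set.finite_range x).isClosed.isOpen_compl (continuousOn_greenFun x ξ) hu.continuousOn
  ext1 j
  have hgreen := tendsto_norm_smul_of_tendsto_sub (tendsto_greenFun_sub hx ξ j)
  have hzero : Tendsto (fun y => ((‖y - x j‖ : ℝ) : ℂ) • u y) (𝓝[≠] x j) (𝓝 0) := by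
    have hcont : Continuous fun y => ((‖y - x j‖ : ℝ) : ℂ) • u y := by fun_prop
    simpa using (hcont.tendsto (x j)).mono_left (nhdsWithin_le_nhds (s := {x j}ᶜ))
  have hξ : ((4 * Real.pi : ℝ) : ℂ)⁻¹ • ξ j = 0 := by
    refine tendsto_nhds_unique (hgreen.congr' ?_) hzero
    filter_upwards [compl_range_mem_nhdsNE hx j] with y hy
    rw [heq hy]
  exact (smul_eq_zero_iff_right (inv_ne_zero four_pi_ne_zero)).1 hξ

theorem greenMap_injective (hx : Function.Injective x) : Function.Injective (greenMap n x) :=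
  (injective_iff_map_eq_zero _).2 fun _ h =>
    eq_zero_of_greenMap_ae_eq hx continuous_zero (h ▸ Lp.coeFn_zero _ _ _)

theorem eq_zero_of_freeResolvent_mem_range (hx : Function.Injective x) {g : L2 n}
    (hg : freeResolvent g ∈ (greenMap n x).range) : g = 0 := by
  have hV : Module.finrank ℝ R3 < 4 := by simp
  obtain ⟨ξ, hξ : greenMap n x ξ = freeResolvent g⟩ := hg
  have hξ₀ : ξ = 0 := eq_zero_of_greenMap_ae_eq hx (continuous_freeResolventFun hV g)
    (hξ ▸ freeResolvent_ae_eq hV g)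
  apply freeResolvent_injective
  rw [← hξ, hξ₀, map_zero, map_zero]

theorem mem_graph_minimalOp_iff {f h : L2 n} :
    (f, h) ∈ (minimalOp n x).graph ↔ freeResolvent (f + h) = f ∧ f ∈ vanishingAt n x := by
  rw [LinearPMap.mem_graph_iff]
  constructor
  · rintro ⟨f', rfl : (f' : L2 n) = f, rfl⟩
    let f₀ : (negLaplacian n).domain := ⟨f', f'.2.2⟩
    have hval : minimalOp n x f' = negLaplacian n f₀ := LinearPMap.domRestrict_apply rfl
    rw [hval]
    exact ⟨freeResolvent_add_negLaplacian f₀, f'.2.1⟩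
  · rintro ⟨hres, hvan⟩
    let f' : (minimalOp n x).domain := ⟨f, hvan, mem_W22_iff.2 ⟨_, hres⟩⟩
    have hval : minimalOp n x f'
        = negLaplacian n ⟨freeResolvent (f + h), freeResolvent_mem_W22 _⟩ :=
      LinearPMap.domRestrict_apply hres.symm
    refine ⟨f', rfl, ?_⟩
    rw [hval, negLaplacian_freeResolvent, hres, add_sub_cancel_left]

theorem isResolventRestriction_minimalOp (n : ℕ) (hx : Function.Injective x) :
    IsResolventRestriction freeResolvent (greenMap n x).range (minimalOp n x) where
  isSymmetric := isSymmetric_freeResolvent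
  eq_zero_of_apply_mem _ := eq_zero_of_freeResolvent_mem_range hx
  mem_graph_iff := by
    rintro ⟨f, h⟩
    rw [mem_graph_minimalOp_iff, ← freeResolvent_mem_vanishingAt_iff]
    exact and_congr_right fun hres => by rw [hres]

theorem mem_domain_adjoint_minimalOp_iff (hx : Function.Injective x) {f : L2 n} :
    f ∈ (minimalOp n x)†.domain ↔ ∃ ξ₀ ξ₁ : Fin m → Cn n,
      ∃ fH ∈ (minimalOp n x).domain, f = singularSum x ξ₀ ξ₁ + fH := by
  have hH := isResolventRestriction_minimalOp n hx
  rw [hH.mem_domain_adjoint_iff]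
  constructor
  · rintro ⟨_, ⟨ξ, rfl⟩, g, rfl⟩
    obtain ⟨_, ⟨η, rfl⟩, g', hg', rfl⟩ :=
      (greenMap n x).range.exists_add_mem_mem_orthogonal g
    refine ⟨(((4 * Real.pi : ℝ) : ℂ)⁻¹ • ξ : BdSpace m n),
      ((2 * ((4 * Real.pi : ℝ) : ℂ))⁻¹ • η : BdSpace m n), freeResolvent g',
      hH.mem_domain_iff.2 ⟨g', hg', rfl⟩, ?_⟩
    rw [singularSum_eq, WithLp.toLp_ofLp, WithLp.toLp_ofLp, smul_inv_smul₀ four_pi_ne_zero,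
      smul_inv_smul₀ (mul_ne_zero two_ne_zero four_pi_ne_zero), map_add, add_assoc]
    rfl
  · rintro ⟨ξ₀, ξ₁, fH, hfH, rfl⟩
    obtain ⟨g, -, rfl⟩ := hH.mem_domain_iff.1 hfH
    rw [singularSum_eq, add_assoc, ← map_add]
    exact ⟨_, ⟨_, rfl⟩, _, rfl⟩

theorem eq_zero_of_singularSum_mem_domain (hx : Function.Injective x) {ξ₀ ξ₁ : Fin m → Cn n}
    (h : singularSum x ξ₀ ξ₁ ∈ (minimalOp n x).domain) : ξ₀ = 0 ∧ ξ₁ = 0 := by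
  have hH := isResolventRestriction_minimalOp n hx
  have hG := greenMap_injective (n := n) hx
  obtain ⟨g, hg, hgs⟩ := hH.mem_domain_iff.1 h
  rw [singularSum_eq, ← zero_add (freeResolvent g), ← map_zero (greenMap n x)] at hgs
  obtain ⟨h₀, hg'⟩ := hH.eq_and_eq_of_add_apply_eq hG hgs.symm
  have hg₀ : g = 0 :=
    inner_self_eq_zero.1 ((Submodule.mem_orthogonal _ _).1 hg g (hg'.symm ▸ ⟨_, rfl⟩))
  have h₁ := hG (hg'.trans (hg₀.trans (map_zero (greenMap n x)).symm))
  have h₀' := (smul_eq_zero_iff_right four_pi_ne_zero).1 h₀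
  have h₁' := (smul_eq_zero_iff_right (mul_ne_zero two_ne_zero four_pi_ne_zero)).1 h₁
  exact ⟨congrArg WithLp.ofLp h₀', congrArg WithLp.ofLp h₁'⟩

theorem hasBoundaryValues_singularCoeff_regularValue (hx : Function.Injective x)
    (hH : IsResolventRestriction freeResolvent (greenMap n x).range (minimalOp n x))
    (hG : Function.Injective (greenMap n x)) (f : (minimalOp n x)†.domain) :
    HasBoundaryValues x (f : L2 n) (hH.singularCoeff hG f)
      (hH.regularValue hG (greenFinitePart x) f) := by
  have h := hasBoundaryValues hx (hH.singularCoeff hG f) ((f : L2 n) + (minimalOp n x)† f)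
  rwa [hH.singularCoeff_add hG f] at h

theorem singularCoeff_of_eq_singularSum_add
    (hH : IsResolventRestriction freeResolvent (greenMap n x).range (minimalOp n x))
    (hG : Function.Injective (greenMap n x)) {f : (minimalOp n x)†.domain}
    {ξ₀ ξ₁ : Fin m → Cn n} {fH : L2 n} (hfH : fH ∈ (minimalOp n x).domain)
    (hf : (f : L2 n) = singularSum x ξ₀ ξ₁ + fH) :
    hH.singularCoeff hG f = ((4 * Real.pi : ℝ) : ℂ) • WithLp.toLp 2 ξ₀ := by
  obtain ⟨g, -, rfl⟩ := hH.mem_domain_iff.1 hfH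
  rw [singularSum_eq, add_assoc, ← map_add] at hf
  exact (hH.singularCoeff_eq_and_eq hG hf).1

theorem domain_eq_W22 {H : L2 n →ₗ.[ℂ] L2 n} (hH : IsResolventRestriction freeResolvent ⊥ H) :
    H.domain = W22 n := by
  ext f
  simp [hH.mem_domain_iff, mem_W22_iff]

end MinimalOp

end PointInteraction

open PointInteraction in
theorem proposition4p1 (m n : ℕ) (x : Fin m → PointInteraction.R3)
    (hx : Function.Injective x) :
    -- (i) the domain of `H*`; the sum is direct and the coefficients are unique
    (((PointInteraction.minimalOp n x)†.domain : Set (PointInteraction.L2 n)) =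
      {f | ∃ ξ₀ ξ₁ : Fin m → PointInteraction.Cn n,
        ∃ fH ∈ (PointInteraction.minimalOp n x).domain,
          f = PointInteraction.singularSum x ξ₀ ξ₁ + fH}) ∧
    (∀ ξ₀ ξ₁ : Fin m → PointInteraction.Cn n,
      PointInteraction.singularSum x ξ₀ ξ₁ ∈ (PointInteraction.minimalOp n x).domain →
        ξ₀ = 0 ∧ ξ₁ = 0) ∧
    -- (ii) the limits define linear maps on `dom H*` that form a boundary triplet
    ∃ Γ₀ Γ₁ : (PointInteraction.minimalOp n x)†.domain →ₗ[ℂ] PointInteraction.BdSpace m n,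
      (∀ f : (PointInteraction.minimalOp n x)†.domain,
        PointInteraction.HasBoundaryValues x (f : PointInteraction.L2 n) (Γ₀ f) (Γ₁ f)) ∧
      (∀ f : (PointInteraction.minimalOp n x)†.domain,
        ∀ ξ₀ ξ₁ : Fin m → PointInteraction.Cn n,
          ∀ fH ∈ (PointInteraction.minimalOp n x).domain,
            (f : PointInteraction.L2 n) = PointInteraction.singularSum x ξ₀ ξ₁ + fH →
              ∀ j, Γ₀ f j = ((4 * Real.pi : ℝ) : ℂ) • ξ₀ j) ∧
      PointInteraction.IsBoundaryTriplet (PointInteraction.minimalOp n x) Γ₀ Γ₁ ∧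
    -- (iii) the extension `H₀`
      IsSelfAdjoint
        (PointInteraction.adjointRestrictKer (PointInteraction.minimalOp n x) Γ₀) ∧
      (PointInteraction.adjointRestrictKer (PointInteraction.minimalOp n x) Γ₀).domain =
        PointInteraction.W22 n := by
  have hH := isResolventRestriction_minimalOp n hx
  have hG := greenMap_injective (n := n) hx
  have hH₀ := hH.adjointRestrictKer hG
  exact ⟨Set.ext fun _ => mem_domain_adjoint_minimalOp_iff hx,
    fun _ _ => eq_zero_of_singularSum_mem_domain hx,
    hH.singularCoeff hG, hH.regularValue hG (greenFinitePart x),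
    hasBoundaryValues_singularCoeff_regularValue hx hH hG,
    fun f ξ₀ ξ₁ fH hfH hf j => by rw [singularCoeff_of_eq_singularSum_add hH hG hfH hf]; rfl,
    hH.isBoundaryTriplet hG (isSymmetric_greenFinitePart x),
    hH₀.isSelfAdjoint, domain_eq_W22 hH₀⟩
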